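/- Let $u:\mathbb{R}^2\times(0,1]\to S^2\subset\mathbb{R}^3$ be a classical wave map, that is, $u$ is a $C^\infty$ map on $\mathbb{R}^2\times(0,1]$ with $|u|\equiv 1$ which satisfies $$\partial_{tt}u-\Delta u=\left(|\nabla u|^2-|\partial_t u|^2\right)u\quad\text{in }\mathbb{R}^2\times(0,1],$$ and there are a constant $u_\infty\in S^2$ and $R>0$ with $u(x,t)=u_\infty$ for all $|x|>R$ and $t\in(0,1]$. (No regularity at $t=0$ is assumed.) Then for all sequences of real numbers $\tau_n\to 0+$ and $\gamma_n\to 1-$ as $n\to\infty$, $$\lim_{n\to\infty}\int_{B_{\tau_n}\setminus B_{\gamma_n\tau_n}}\left(\frac{|\nabla u|^2}{2}+\frac{|\partial_t u|^2}{2}+\sum_{j=1}^2\frac{x_j}{|x|}\,\partial_{x_j}u\cdot\partial_t u\right)(x,\tau_n)\,dx=0,$$ where $B_r=\{x\in\mathbb{R}^2:|x|<r\}$ and $|\nabla u|^2=\sum_{j=1}^2|\partial_{x_j}u|^2$. -/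

import Mathlib

open scoped ContDiff

noncomputable section

namespace WaveMap

/-- The partial derivative `∂u/∂x_j` at the point `x` and time `t`. -/
def dx (u : EuclideanSpace ℝ (Fin 2) → ℝ → EuclideanSpace ℝ (Fin 3)) (j : Fin 2)
    (x : EuclideanSpace ℝ (Fin 2)) (t : ℝ) : EuclideanSpace ℝ (Fin 3) :=
  fderiv ℝ (fun y => u y t) x (EuclideanSpace.single j 1)

/-- The time derivative `∂u/∂t` of a map defined on `ℝ² × (0,1]`
(two-sided for `0 < t < 1`, one-sided at `t = 1`). -/
def dt (u : EuclideanSpace ℝ (Fin 2) → ℝ → EuclideanSpace ℝ (Fin 3))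
    (x : EuclideanSpace ℝ (Fin 2)) (t : ℝ) : EuclideanSpace ℝ (Fin 3) :=
  derivWithin (fun s => u x s) (Set.Ioc 0 1) t

/-- `|∇u|² = ∑ⱼ |∂ⱼu|²`, the gradient being taken in the space variables. -/
def gradSq (u : EuclideanSpace ℝ (Fin 2) → ℝ → EuclideanSpace ℝ (Fin 3))
    (x : EuclideanSpace ℝ (Fin 2)) (t : ℝ) : ℝ :=
  ∑ j : Fin 2, ‖dx u j x t‖ ^ 2

/-- A classical wave map on `ℝ² × (0,1]` with values in the unit sphere of `ℝ³`: it is smooth,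
sphere-valued, equal to a fixed constant for large `x`, and satisfies
`∂ₜₜu - Δu = (|∇u|² - |∂ₜu|²) u`. -/
structure IsClassical (u : EuclideanSpace ℝ (Fin 2) → ℝ → EuclideanSpace ℝ (Fin 3)) : Prop where
  smooth : ContDiffOn ℝ ∞ (fun p : EuclideanSpace ℝ (Fin 2) × ℝ => u p.1 p.2)
    (Set.univ ×ˢ Set.Ioc (0 : ℝ) 1)
  sphere : ∀ x, ∀ t ∈ Set.Ioc (0 : ℝ) 1, ‖u x t‖ = 1
  const_at_infinity : ∃ c : EuclideanSpace ℝ (Fin 3), ∃ R : ℝ,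
    ∀ x, ∀ t ∈ Set.Ioc (0 : ℝ) 1, R < ‖x‖ → u x t = c
  equation : ∀ x, ∀ t ∈ Set.Ioc (0 : ℝ) 1,
    dt (dt u) x t - Laplacian.laplacian (fun y => u y t) x
      = (gradSq u x t - ‖dt u x t‖ ^ 2) • u x t

/-- The energy density with the outgoing cross term,
`|∇u|²/2 + |∂ₜu|²/2 + (x/|x|)·∇u · ∂ₜu`. -/
def fluxDensity (u : EuclideanSpace ℝ (Fin 2) → ℝ → EuclideanSpace ℝ (Fin 3))
    (x : EuclideanSpace ℝ (Fin 2)) (t : ℝ) : ℝ :=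
  gradSq u x t / 2 + ‖dt u x t‖ ^ 2 / 2
    + ∑ j : Fin 2, (x j / ‖x‖) * inner ℝ (dx u j x t) (dt u x t)

end WaveMap

end

noncomputable section

namespace WaveMap

open MeasureTheory Set Filter Topology

/-! The argument is a multiplier estimate with the scaling field `t ∂ₜ + x · ∇`. Write `q = |x|² -
t²`, `E` for the energy density and `D = t E + x · m` for the scaling density, with `m` the
momentum. For `|x| ≤ t` the density `D` dominates `|x|` times the flux density, so it suffices to
bound `D` at time `τ` on the layer `|q| ≤ a = τ²(1 - γ²)` inside the cone.

Testing energy conservation with a weight `k(q)` produces exactly the space-time integral of `-2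
k'(q) D`. If `k` is a bounded arctangent of size `a`, then `D` integrated over the layer and over
all times in `[s, τ]` is `O(a)` (`integral_bump_scalingDensity_le`). To pass from a time average to
the single time `τ`, the scaling law is tested with `(t - s) k(q)` (`scaling_balance`). The
dangerous term contains `k'(q)` times the flux `M` of `D` through the level sets of `q`, and `M + q
L = |t ∂ₜv + x · ∇v|² ≥ 0` with `L` the Lagrangian density (`scalingFlux_add_eq`). Hence inside the
cone, where `k' ≥ 0`, that term is at most `(τ - s) E`. Outside, where `k' ≤ 0`, it is compared with
the energy flux through the cone.

The weight `bump a b` has width `a` inside the cone and `b` outside; as `b → 0` the outer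
contribution becomes the increment of the energy inside the cone between `s` and `τ`. This energy is
monotone and nonnegative, so it converges as `t → 0+` and its increments between `(1 - ε) τ` and `τ`
vanish. With `s = (1 - ε) τ`, division by `ε τ²` gives `annulusFlux_bound`: the flux is controlled
by `(1 - γ²)/ε`, an energy increment, and `ε`. Let `n → ∞`, then `ε → 0`.

Only times strictly between `0` and `1` enter, so the one-sided derivative at `t = 1` plays no role.
-/

/-- The spatial domain `ℝ²`. -/
abbrev Plane := EuclideanSpace ℝ (Fin 2)

/-- The open space-time slab `ℝ² × (0,1)`. -/
def slab : Set (Plane × ℝ) := univ ×ˢ Ioo 0 1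

/-- The unit vector of the `j`-th space direction in space-time. -/
def sdir (j : Fin 2) : Plane × ℝ := (EuclideanSpace.single j 1, 0)

/-- The unit vector of the time direction in space-time. -/
def tdir : Plane × ℝ := (0, 1)

/-- The derivative of `f` at `p` in the direction `d`. -/
def pd {V : Type*} [NormedAddCommGroup V] [NormedSpace ℝ V] (d : Plane × ℝ)
    (f : Plane × ℝ → V) (p : Plane × ℝ) : V := fderiv ℝ f p d

/-- `f` vanishes in the slab at distance more than `R` from the time axis. -/
def VanishesOutside {V : Type*} [Zero V] (R : ℝ) (f : Plane × ℝ → V) : Prop :=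
  ∀ p ∈ slab, R < ‖p.1‖ → f p = 0

lemma isOpen_slab : IsOpen slab := isOpen_univ.prod isOpen_Ioo

lemma mem_slab {p : Plane × ℝ} : p ∈ slab ↔ 0 < p.2 ∧ p.2 < 1 := by
  simp [slab]

/-! ### Directional derivatives on the open slab. -/

section Calculus

variable {V : Type*} [NormedAddCommGroup V] [NormedSpace ℝ V]

lemma contDiffOn_pd {f : Plane × ℝ → V} (hf : ContDiffOn ℝ ∞ f slab) (d : Plane × ℝ) :
    ContDiffOn ℝ ∞ (pd d f) slab :=
  (hf.fderiv_of_isOpen isOpen_slab (by simp)).clm_apply contDiffOn_const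

lemma continuousOn_pd {f : Plane × ℝ → V} (hf : ContDiffOn ℝ 1 f slab) (d : Plane × ℝ) :
    ContinuousOn (pd d f) slab :=
  (hf.continuousOn_fderiv_of_isOpen isOpen_slab le_rfl).clm_apply continuousOn_const

lemma differentiableAt_of_contDiffOn_slab {f : Plane × ℝ → V} {n : ℕ∞ω} (hn : n ≠ 0)
    (hf : ContDiffOn ℝ n f slab) {p : Plane × ℝ} (hp : p ∈ slab) : DifferentiableAt ℝ f p :=
  (hf.differentiableOn hn).differentiableAt (isOpen_slab.mem_nhds hp)

lemma isOpen_far (R : ℝ) : IsOpen {p : Plane × ℝ | R < ‖p.1‖} :=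
  isOpen_lt continuous_const (by fun_prop)

lemma VanishesOutside.pd {R : ℝ} {f : Plane × ℝ → V} (hf : VanishesOutside R f)
    (d : Plane × ℝ) : VanishesOutside R (pd d f) := by
  intro p hp hR
  have h : f =ᶠ[𝓝 p] fun _ => 0 := by
    filter_upwards [isOpen_slab.mem_nhds hp, (isOpen_far R).mem_nhds hR] with y h1 h2
    exact hf y h1 h2
  simp [WaveMap.pd, h.fderiv_eq]

end Calculus

/-! ### Integration over time slices and strips; weighted balance laws. -/

section Integration

variable {R : ℝ} {f : Plane × ℝ → ℝ}

lemma continuous_slice (hf : ContinuousOn f slab) {t : ℝ} (h0 : 0 < t) (h1 : t < 1) :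
    Continuous fun x => f (x, t) :=
  hf.comp_continuous (by fun_prop) fun x => mem_slab.2 ⟨h0, h1⟩

lemma VanishesOutside.hasCompactSupport_slice (hR : VanishesOutside R f) {t : ℝ}
    (h0 : 0 < t) (h1 : t < 1) : HasCompactSupport fun x => f (x, t) :=
  HasCompactSupport.intro (isCompact_closedBall (0 : Plane) R) fun x hx =>
    hR _ (mem_slab.2 ⟨h0, h1⟩) (by simpa using hx)

lemma integrable_slice (hf : ContinuousOn f slab) (hR : VanishesOutside R f) {t : ℝ}
    (h0 : 0 < t) (h1 : t < 1) : Integrable fun x => f (x, t) :=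
  (continuous_slice hf h0 h1).integrable_of_hasCompactSupport
    (hR.hasCompactSupport_slice h0 h1)

lemma strip_subset_slab {s τ : ℝ} (hs : 0 < s) (hτ : τ < 1) :
    (univ : Set Plane) ×ˢ Ioc s τ ⊆ slab := fun _ hp =>
  mem_slab.2 ⟨hs.trans hp.2.1, hp.2.2.trans_lt hτ⟩

lemma measurableSet_strip (s τ : ℝ) : MeasurableSet ((univ : Set Plane) ×ˢ Ioc s τ) :=
  MeasurableSet.univ.prod measurableSet_Ioc

lemma integrableOn_strip (hf : ContinuousOn f slab) (hR : VanishesOutside R f) {s τ : ℝ}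
    (hs : 0 < s) (hτ : τ < 1) : IntegrableOn f ((univ : Set Plane) ×ˢ Ioc s τ) := by
  have hK : IsCompact (Metric.closedBall (0 : Plane) R ×ˢ Icc s τ) :=
    (isCompact_closedBall _ _).prod isCompact_Icc
  have hsub : Metric.closedBall (0 : Plane) R ×ˢ Icc s τ ⊆ slab := fun p hp =>
    mem_slab.2 ⟨hs.trans_le hp.2.1, hp.2.2.trans_lt hτ⟩
  have h1 := (hf.mono hsub).integrableOn_compact (μ := volume) hK
  refine h1.of_forall_sdiff_eq_zero (measurableSet_strip s τ) fun p hp => ?_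
  refine hR p (strip_subset_slab hs hτ hp.1) ?_
  by_contra hlt
  exact hp.2 ⟨by simpa using hlt, hp.1.2.1.le, hp.1.2.2⟩

lemma volume_restrict_strip (s τ : ℝ) :
    (volume : Measure (Plane × ℝ)).restrict ((univ : Set Plane) ×ˢ Ioc s τ)
      = (volume : Measure Plane).prod ((volume : Measure ℝ).restrict (Ioc s τ)) := by
  rw [Measure.volume_eq_prod, ← Measure.prod_restrict, Measure.restrict_univ]

lemma integral_strip_pd_tdir (hf : ContDiffOn ℝ 1 f slab) (hR : VanishesOutside R f)
    {s τ : ℝ} (hs : 0 < s) (hsτ : s ≤ τ) (hτ : τ < 1) :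
    ∫ p in (univ : Set Plane) ×ˢ Ioc s τ, pd tdir f p = (∫ x, f (x, τ)) - ∫ x, f (x, s) := by
  have hc := continuousOn_pd hf tdir
  have hi := integrableOn_strip hc (hR.pd tdir) hs hτ
  rw [IntegrableOn, volume_restrict_strip] at hi
  rw [volume_restrict_strip, integral_prod _ hi, ← integral_sub
    (integrable_slice hf.continuousOn hR (hs.trans_le hsτ) hτ)
    (integrable_slice hf.continuousOn hR hs (hsτ.trans_lt hτ))]
  congr 1
  ext x
  rw [← intervalIntegral.integral_of_le hsτ]
  have hm : ∀ t ∈ uIcc s τ, (x, t) ∈ slab := fun t ht => by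
    rw [uIcc_of_le hsτ] at ht
    exact mem_slab.2 ⟨hs.trans_le ht.1, ht.2.trans_lt hτ⟩
  refine intervalIntegral.integral_eq_sub_of_hasDerivAt (f := fun t => f (x, t)) ?_ ?_
  · intro t ht
    have h1 := (differentiableAt_of_contDiffOn_slab one_ne_zero hf (hm t ht)).hasFDerivAt
    have h2 : HasDerivAt (fun t : ℝ => (x, t)) tdir t :=
      (hasDerivAt_const t x).prodMk (hasDerivAt_id t)
    exact h1.comp_hasDerivAt t h2
  · exact (hc.comp (by fun_prop) hm).intervalIntegrable

lemma integral_slice_pd_sdir (hf : ContDiffOn ℝ 1 f slab) (hR : VanishesOutside R f)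
    (j : Fin 2) {t : ℝ} (h0 : 0 < t) (h1 : t < 1) : ∫ x, pd (sdir j) f (x, t) = 0 := by
  have hd : ∀ x, HasFDerivAt (fun x => f (x, t))
      ((fderiv ℝ f (x, t)).comp (ContinuousLinearMap.inl ℝ Plane ℝ)) x := fun x =>
    (differentiableAt_of_contDiffOn_slab one_ne_zero hf
      (mem_slab.2 ⟨h0, h1⟩ : (x, t) ∈ slab)).hasFDerivAt.comp x (hasFDerivAt_prodMk_left x t)
  -- Integration by parts against the constant function `1`.
  have h := integral_bilinear_hasFDerivAt_right_eq_neg_left_of_integrable (μ := volume)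
    (f := fun _ : Plane => (1 : ℝ)) (f' := fun _ => 0) (g := fun x => f (x, t))
    (v := EuclideanSpace.single j (1 : ℝ)) (B := ContinuousLinearMap.mul ℝ ℝ)
    (g' := fun x => (fderiv ℝ f (x, t)).comp (ContinuousLinearMap.inl ℝ Plane ℝ))
    (by simp) (by
      simpa [pd, sdir] using
        integrable_slice (continuousOn_pd hf (sdir j)) (hR.pd (sdir j)) h0 h1)
    (by simpa using integrable_slice hf.continuousOn hR h0 h1)
    (fun x _ => hasFDerivAt_const _ _) (fun x _ => hd x)
  simpa [pd, sdir] using h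

lemma integral_strip_pd_sdir (hf : ContDiffOn ℝ 1 f slab) (hR : VanishesOutside R f)
    (j : Fin 2) {s τ : ℝ} (hs : 0 < s) (hτ : τ < 1) :
    ∫ p in (univ : Set Plane) ×ˢ Ioc s τ, pd (sdir j) f p = 0 := by
  have hi := integrableOn_strip (continuousOn_pd hf (sdir j)) (hR.pd (sdir j)) hs hτ
  rw [IntegrableOn, volume_restrict_strip] at hi
  rw [volume_restrict_strip, integral_prod_symm _ hi]
  refine setIntegral_eq_zero_of_forall_eq_zero fun t ht => ?_
  exact integral_slice_pd_sdir hf hR j (hs.trans ht.1) (ht.2.trans_lt hτ)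

lemma pd_mul {w f : Plane × ℝ → ℝ} {p : Plane × ℝ} (hw : DifferentiableAt ℝ w p)
    (hf : DifferentiableAt ℝ f p) (d : Plane × ℝ) :
    pd d (fun p => w p * f p) p = pd d w p * f p + w p * pd d f p := by
  simp only [pd]
  rw [fderiv_fun_mul hw hf]
  simp
  ring

/-- The integrated form of a balance law `∂ₜQ = ∑ⱼ ∂ⱼYⱼ + g` tested with a weight `w`. -/
theorem weighted_balance {Q g w : Plane × ℝ → ℝ} {Y : Fin 2 → Plane × ℝ → ℝ}
    (hQ : ContDiffOn ℝ 1 Q slab) (hY : ∀ j, ContDiffOn ℝ 1 (Y j) slab)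
    (hw : ContDiff ℝ 1 w) (hQR : VanishesOutside R Q) (hYR : ∀ j, VanishesOutside R (Y j))
    (law : ∀ p ∈ slab, pd tdir Q p = ∑ j, pd (sdir j) (Y j) p + g p)
    {s τ : ℝ} (hs : 0 < s) (hsτ : s ≤ τ) (hτ : τ < 1) :
    (∫ x, w (x, τ) * Q (x, τ)) - ∫ x, w (x, s) * Q (x, s)
      = ∫ p in (univ : Set Plane) ×ˢ Ioc s τ,
          (pd tdir w p * Q p - ∑ j, pd (sdir j) w p * Y j p + w p * g p) := by
  have hwQ : ContDiffOn ℝ 1 (fun p => w p * Q p) slab := hw.contDiffOn.mul hQ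
  have hwQR : VanishesOutside R (fun p => w p * Q p) := fun p hp h => by simp [hQR p hp h]
  have hwY : ∀ j, ContDiffOn ℝ 1 (fun p => w p * Y j p) slab := fun j =>
    hw.contDiffOn.mul (hY j)
  have hwYR : ∀ j, VanishesOutside R (fun p => w p * Y j p) := fun j p hp h => by
    simp [hYR j p hp h]
  have hI : ∀ j, IntegrableOn (pd (sdir j) (fun p => w p * Y j p))
      ((univ : Set Plane) ×ˢ Ioc s τ) := fun j =>
    integrableOn_strip (continuousOn_pd (hwY j) _) ((hwYR j).pd _) hs hτ
  rw [← integral_strip_pd_tdir hwQ hwQR hs hsτ hτ]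
  -- The divergence of `w Y` integrates to zero, so it may be subtracted from the time derivative of
  -- `w Q`; this removes the derivatives of `Y`.
  have h0 : ∫ p in (univ : Set Plane) ×ˢ Ioc s τ,
      ∑ j, pd (sdir j) (fun p => w p * Y j p) p = 0 := by
    rw [integral_finsetSum _ fun j _ => hI j]
    simp [integral_strip_pd_sdir (hwY _) (hwYR _) _ hs hτ]
  rw [← sub_zero (∫ p in _, pd tdir _ p), ← h0, ← integral_sub
    (integrableOn_strip (continuousOn_pd hwQ _) (hwQR.pd _) hs hτ)
    (integrable_finsetSum _ fun j _ => hI j)]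
  refine setIntegral_congr_fun (measurableSet_strip s τ) fun p hp => ?_
  have hp' := strip_subset_slab hs hτ hp
  have hwp : DifferentiableAt ℝ w p := hw.differentiable one_ne_zero p
  have hQp := differentiableAt_of_contDiffOn_slab one_ne_zero hQ hp'
  have hYp := fun j => differentiableAt_of_contDiffOn_slab one_ne_zero (hY j) hp'
  simp only [pd_mul hwp hQp, pd_mul hwp (hYp _), law p hp', Fin.sum_univ_two]
  ring

end Integration

/-! ### Reduction of a classical wave map to its orthogonality relations on the open slab. -/

/-- The target space `ℝ³`. -/
abbrev Target := EuclideanSpace ℝ (Fin 3)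

/-- The facts about a wave map, as a function on the open slab, that enter the energy estimates:
the wave operator is normal to the velocity and to the space derivatives, and all derivatives
vanish for large `x`. -/
structure IsNormalWave (v : Plane × ℝ → Target) (R : ℝ) : Prop where
  smooth : ContDiffOn ℝ ∞ v slab
  normal : ∀ p ∈ slab, ∀ d, inner ℝ (pd d v p)
    (pd tdir (pd tdir v) p - ∑ j, pd (sdir j) (pd (sdir j) v) p) = 0
  vanishes : ∀ d, VanishesOutside R (pd d v)

section Classical

variable {u : Plane → ℝ → Target}

lemma IsClassical.contDiffOn_slab (hu : IsClassical u) :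
    ContDiffOn ℝ ∞ (fun p : Plane × ℝ => u p.1 p.2) slab :=
  hu.smooth.mono (prod_mono_right Ioo_subset_Ioc_self)

lemma IsClassical.dx_eq (hu : IsClassical u) (j : Fin 2) {p : Plane × ℝ} (hp : p ∈ slab) :
    dx u j p.1 p.2 = pd (sdir j) (fun p : Plane × ℝ => u p.1 p.2) p := by
  have h := (differentiableAt_of_contDiffOn_slab (by simp) hu.contDiffOn_slab hp).hasFDerivAt
  have h2 := HasFDerivAt.comp (f := fun y : Plane => (y, p.2)) p.1 h
    (hasFDerivAt_prodMk_left p.1 p.2)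
  have h3 : HasFDerivAt (fun y => u y p.2) _ p.1 := h2
  simp [dx, pd, sdir, h3.fderiv]

lemma hasDerivAt_time {V : Type*} [NormedAddCommGroup V] [NormedSpace ℝ V]
    {f : Plane × ℝ → V} {p : Plane × ℝ} (hf : DifferentiableAt ℝ f p) :
    HasDerivAt (fun s => f (p.1, s)) (pd tdir f p) p.2 :=
  HasFDerivAt.comp_hasDerivAt (f := fun s : ℝ => (p.1, s)) p.2 hf.hasFDerivAt
    ((hasDerivAt_const p.2 p.1).prodMk (hasDerivAt_id p.2))

lemma derivWithin_Ioc_eq {V : Type*} [NormedAddCommGroup V] [NormedSpace ℝ V]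
    {f : Plane × ℝ → V} {p : Plane × ℝ} (hp : p ∈ slab) (hf : DifferentiableAt ℝ f p) :
    derivWithin (fun s => f (p.1, s)) (Ioc 0 1) p.2 = pd tdir f p := by
  rw [derivWithin_of_mem_nhds (Ioc_mem_nhds (mem_slab.1 hp).1 (mem_slab.1 hp).2)]
  exact (hasDerivAt_time hf).deriv

lemma IsClassical.dt_eq (hu : IsClassical u) {p : Plane × ℝ} (hp : p ∈ slab) :
    dt u p.1 p.2 = pd tdir (fun p : Plane × ℝ => u p.1 p.2) p :=
  derivWithin_Ioc_eq (f := fun p : Plane × ℝ => u p.1 p.2) hp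
    (differentiableAt_of_contDiffOn_slab (by simp) hu.contDiffOn_slab hp)

lemma IsClassical.dt_dt_eq (hu : IsClassical u) {p : Plane × ℝ} (hp : p ∈ slab) :
    dt (dt u) p.1 p.2 = pd tdir (pd tdir (fun p : Plane × ℝ => u p.1 p.2)) p := by
  rw [← derivWithin_Ioc_eq hp (differentiableAt_of_contDiffOn_slab (n := ∞) (by simp)
    (contDiffOn_pd hu.contDiffOn_slab _) hp)]
  have hs := mem_slab.1 hp
  rw [dt, derivWithin_of_mem_nhds (Ioc_mem_nhds hs.1 hs.2),
    derivWithin_of_mem_nhds (Ioc_mem_nhds hs.1 hs.2)]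
  refine Filter.EventuallyEq.deriv_eq ?_
  filter_upwards [Ioo_mem_nhds hs.1 hs.2] with s hs
  exact hu.dt_eq (p := (p.1, s)) (mem_slab.2 hs)

lemma IsClassical.laplacian_eq (hu : IsClassical u) {p : Plane × ℝ} (hp : p ∈ slab) :
    Laplacian.laplacian (fun y => u y p.2) p.1
      = ∑ j, pd (sdir j) (pd (sdir j) (fun p : Plane × ℝ => u p.1 p.2)) p := by
  rw [InnerProductSpace.laplacian_eq_iteratedFDeriv_orthonormalBasis _
    (EuclideanSpace.basisFun (Fin 2) ℝ)]
  refine Finset.sum_congr rfl fun j _ => ?_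
  have hmem : ∀ y : Plane, (y, p.2) ∈ slab := fun y => mem_slab.2 (mem_slab.1 hp)
  have hsm : ContDiff ℝ ∞ fun y => u y p.2 := by
    rw [← contDiffOn_univ]
    exact hu.contDiffOn_slab.comp (f := fun y : Plane => (y, p.2)) (by fun_prop)
      fun y _ => hmem y
  rw [iteratedFDeriv_two_apply]
  simp only [EuclideanSpace.basisFun_apply, Matrix.cons_val_zero, Matrix.cons_val_one]
  have h1 : HasFDerivAt (fun y => pd (sdir j) (fun p : Plane × ℝ => u p.1 p.2) (y, p.2)) _ p.1 :=
    HasFDerivAt.comp (f := fun y : Plane => (y, p.2)) p.1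
      (differentiableAt_of_contDiffOn_slab (n := ∞) (by simp)
        (contDiffOn_pd hu.contDiffOn_slab (sdir j)) hp).hasFDerivAt
      (hasFDerivAt_prodMk_left p.1 p.2)
  have h2 : (fun y => pd (sdir j) (fun p : Plane × ℝ => u p.1 p.2) (y, p.2))
      = fun y => fderiv ℝ (fun y => u y p.2) y (EuclideanSpace.single j 1) :=
    funext fun y => (hu.dx_eq j (hmem y)).symm
  rw [h2] at h1
  have h3 : HasFDerivAt (fderiv ℝ fun y => u y p.2)
      (fderiv ℝ (fderiv ℝ fun y => u y p.2) p.1) p.1 :=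
    ((hsm.fderiv_right (m := ∞) (by simp)).differentiable (by simp) p.1).hasFDerivAt
  have h4 := h3.clm_apply (hasFDerivAt_const (EuclideanSpace.single j (1 : ℝ)) p.1)
  have h5 := congrArg (fun L : Plane →L[ℝ] Target => L (EuclideanSpace.single j (1 : ℝ))) (h1.unique h4)
  simpa [pd, sdir] using h5.symm

/-- Differentiate `|u|² = 1`. Since the wave operator is a multiple of `u`, it is therefore
orthogonal to every derivative of `u`. -/
lemma IsClassical.inner_pd_eq_zero (hu : IsClassical u) (d : Plane × ℝ) {p : Plane × ℝ}
    (hp : p ∈ slab) :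
    inner ℝ (pd d (fun p : Plane × ℝ => u p.1 p.2) p) (u p.1 p.2) = 0 := by
  have hd := differentiableAt_of_contDiffOn_slab (by simp) hu.contDiffOn_slab hp
  have h1 : (fun p : Plane × ℝ => inner ℝ (u p.1 p.2) (u p.1 p.2)) =ᶠ[𝓝 p] fun _ => (1 : ℝ) := by
    filter_upwards [isOpen_slab.mem_nhds hp] with y hy
    have hy := mem_slab.1 hy
    simp [hu.sphere y.1 y.2 ⟨hy.1, hy.2.le⟩]
  have h2 := congrArg (fun L : Plane × ℝ →L[ℝ] ℝ => L d) h1.fderiv_eq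
  simp only [fderiv_inner_apply ℝ hd hd, fderiv_fun_const] at h2
  rw [real_inner_comm] at h2
  simp only [pd]
  have : (0 : Plane × ℝ → (Plane × ℝ →L[ℝ] ℝ)) p d = 0 := rfl
  linarith

lemma IsClassical.exists_isNormalWave (hu : IsClassical u) :
    ∃ R, IsNormalWave (fun p : Plane × ℝ => u p.1 p.2) R := by
  obtain ⟨c, R, hc⟩ := hu.const_at_infinity
  refine ⟨R, hu.contDiffOn_slab, fun p hp d => ?_, fun d p hp hR => ?_⟩
  · have hs := mem_slab.1 hp
    rw [← hu.dt_dt_eq hp, ← hu.laplacian_eq hp, hu.equation p.1 p.2 ⟨hs.1, hs.2.le⟩,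
      inner_smul_right, hu.inner_pd_eq_zero d hp, mul_zero]
  · have h : (fun p : Plane × ℝ => u p.1 p.2) =ᶠ[𝓝 p] fun _ => c := by
      filter_upwards [isOpen_slab.mem_nhds hp, (isOpen_far R).mem_nhds hR] with y h1 h2
      have h1 := mem_slab.1 h1
      exact hc y.1 y.2 ⟨h1.1, h1.2.le⟩ h2
    simp [pd, h.fderiv_eq]

end Classical

/-! ### Densities and currents of the stress-energy tensor. -/

section Densities

variable (v : Plane × ℝ → Target)

/-- The energy density. -/
def energyDensity (p : Plane × ℝ) : ℝ :=
  (∑ j, ‖pd (sdir j) v p‖ ^ 2 + ‖pd tdir v p‖ ^ 2) / 2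

/-- The Lagrangian density. -/
def lagrangian (p : Plane × ℝ) : ℝ :=
  (∑ j, ‖pd (sdir j) v p‖ ^ 2 - ‖pd tdir v p‖ ^ 2) / 2

/-- The momentum density. -/
def momentum (j : Fin 2) (p : Plane × ℝ) : ℝ :=
  inner ℝ (pd (sdir j) v p) (pd tdir v p)

/-- The products of the space derivatives. -/
def gradGram (i j : Fin 2) (p : Plane × ℝ) : ℝ :=
  inner ℝ (pd (sdir i) v p) (pd (sdir j) v p)

/-- The charge density belonging to the scaling field `t ∂ₜ + x · ∇`. -/
def scalingDensity (p : Plane × ℝ) : ℝ :=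
  p.2 * energyDensity v p + ∑ j, p.1 j * momentum v j p

/-- The current belonging to the scaling field `t ∂ₜ + x · ∇`. -/
def scalingCurrent (j : Fin 2) (p : Plane × ℝ) : ℝ :=
  p.2 * momentum v j p + ∑ i, p.1 i * gradGram v i j p - p.1 j * lagrangian v p

end Densities

/-! ### Local conservation laws. -/

section Laws

variable {v : Plane × ℝ → Target} {R : ℝ}

lemma IsNormalWave.contDiffOn_inner (hv : IsNormalWave v R) (d e : Plane × ℝ) :
    ContDiffOn ℝ ∞ (fun p => inner ℝ (pd d v p) (pd e v p)) slab :=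
  (contDiffOn_pd hv.smooth d).inner ℝ (contDiffOn_pd hv.smooth e)

lemma IsNormalWave.contDiffOn_normSq (hv : IsNormalWave v R) (d : Plane × ℝ) :
    ContDiffOn ℝ ∞ (fun p => ‖pd d v p‖ ^ 2) slab :=
  (contDiffOn_pd hv.smooth d).norm_sq ℝ

lemma IsNormalWave.contDiffOn_energyDensity (hv : IsNormalWave v R) :
    ContDiffOn ℝ ∞ (energyDensity v) slab :=
  ((ContDiffOn.sum fun j _ => hv.contDiffOn_normSq (sdir j)).add
    (hv.contDiffOn_normSq tdir)).div_const 2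

lemma IsNormalWave.contDiffOn_lagrangian (hv : IsNormalWave v R) :
    ContDiffOn ℝ ∞ (lagrangian v) slab :=
  ((ContDiffOn.sum fun j _ => hv.contDiffOn_normSq (sdir j)).sub
    (hv.contDiffOn_normSq tdir)).div_const 2

lemma contDiff_coord (j : Fin 2) : ContDiff ℝ ∞ fun p : Plane × ℝ => p.1 j := by
  fun_prop

lemma IsNormalWave.contDiffOn_scalingDensity (hv : IsNormalWave v R) :
    ContDiffOn ℝ ∞ (scalingDensity v) slab :=
  (contDiff_snd.contDiffOn.mul hv.contDiffOn_energyDensity).add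
    (ContDiffOn.sum fun j _ => (contDiff_coord j).contDiffOn.mul (hv.contDiffOn_inner _ _))

lemma IsNormalWave.contDiffOn_scalingCurrent (hv : IsNormalWave v R) (j : Fin 2) :
    ContDiffOn ℝ ∞ (scalingCurrent v j) slab :=
  ((contDiff_snd.contDiffOn.mul (hv.contDiffOn_inner _ _)).add
    (ContDiffOn.sum fun i _ => (contDiff_coord i).contDiffOn.mul (hv.contDiffOn_inner _ _))).sub
    ((contDiff_coord j).contDiffOn.mul hv.contDiffOn_lagrangian)

lemma IsNormalWave.vanishes_energyDensity (hv : IsNormalWave v R) :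
    VanishesOutside R (energyDensity v) := fun p hp h => by
  simp [energyDensity, hv.vanishes _ p hp h]

lemma IsNormalWave.vanishes_lagrangian (hv : IsNormalWave v R) :
    VanishesOutside R (lagrangian v) := fun p hp h => by
  simp [lagrangian, hv.vanishes _ p hp h]

lemma IsNormalWave.vanishes_momentum (hv : IsNormalWave v R) (j : Fin 2) :
    VanishesOutside R (momentum v j) := fun p hp h => by
  simp [momentum, hv.vanishes _ p hp h]

lemma IsNormalWave.vanishes_scalingDensity (hv : IsNormalWave v R) :
    VanishesOutside R (scalingDensity v) := fun p hp h => by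
  simp [scalingDensity, hv.vanishes_energyDensity p hp h, hv.vanishes_momentum _ p hp h]

lemma IsNormalWave.vanishes_scalingCurrent (hv : IsNormalWave v R) (j : Fin 2) :
    VanishesOutside R (scalingCurrent v j) := fun p hp h => by
  simp [scalingCurrent, gradGram, hv.vanishes_lagrangian p hp h,
    hv.vanishes_momentum _ p hp h, hv.vanishes _ p hp h]

lemma IsNormalWave.differentiableAt_pd (hv : IsNormalWave v R) (d : Plane × ℝ)
    {p : Plane × ℝ} (hp : p ∈ slab) : DifferentiableAt ℝ (pd d v) p :=
  differentiableAt_of_contDiffOn_slab (n := ∞) (by simp) (contDiffOn_pd hv.smooth d) hp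

lemma IsNormalWave.pd_comm (hv : IsNormalWave v R) (d e : Plane × ℝ)
    {p : Plane × ℝ} (hp : p ∈ slab) : pd d (pd e v) p = pd e (pd d v) p := by
  have hc : ContDiffAt ℝ ∞ v p := hv.smooth.contDiffAt (isOpen_slab.mem_nhds hp)
  have hs : IsSymmSndFDerivAt ℝ v p := hc.isSymmSndFDerivAt (by
    simpa using (WithTop.coe_le_coe.2 (le_top : (2 : ℕ∞) ≤ ⊤)))
  have hd : DifferentiableAt ℝ (fderiv ℝ v) p :=
    (hc.fderiv_right (m := ∞) (by simp)).differentiableAt (by simp)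
  have key : ∀ d e : Plane × ℝ, pd d (pd e v) p = fderiv ℝ (fderiv ℝ v) p d e := fun d e => by
    have := (hd.hasFDerivAt.clm_apply (hasFDerivAt_const e p)).fderiv
    change fderiv ℝ (fun y => fderiv ℝ v y e) p d = _
    rw [this]
    simp
  rw [key, key, hs]

lemma IsNormalWave.pd_inner (hv : IsNormalWave v R) (d a b : Plane × ℝ)
    {p : Plane × ℝ} (hp : p ∈ slab) :
    pd d (fun p => inner ℝ (pd a v p) (pd b v p)) p
      = inner ℝ (pd d (pd a v) p) (pd b v p) + inner ℝ (pd d (pd b v) p) (pd a v p) := by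
  change fderiv ℝ _ p d = _
  rw [fderiv_inner_apply ℝ (hv.differentiableAt_pd a hp) (hv.differentiableAt_pd b hp),
    real_inner_comm]
  simp only [pd]
  ring

lemma pd_add {f g : Plane × ℝ → ℝ} {p : Plane × ℝ} (hf : DifferentiableAt ℝ f p)
    (hg : DifferentiableAt ℝ g p) (d : Plane × ℝ) :
    pd d (fun p => f p + g p) p = pd d f p + pd d g p := by
  simp [pd, fderiv_fun_add hf hg]

lemma pd_sub {f g : Plane × ℝ → ℝ} {p : Plane × ℝ} (hf : DifferentiableAt ℝ f p)
    (hg : DifferentiableAt ℝ g p) (d : Plane × ℝ) :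
    pd d (fun p => f p - g p) p = pd d f p - pd d g p := by
  simp [pd, fderiv_fun_sub hf hg]

lemma pd_div_const {f : Plane × ℝ → ℝ} {p : Plane × ℝ} (hf : DifferentiableAt ℝ f p)
    (c : ℝ) (d : Plane × ℝ) : pd d (fun p => f p / c) p = pd d f p / c := by
  simp only [div_eq_mul_inv, pd]
  rw [fderiv_mul_const hf]
  simp [mul_comm]

lemma pd_coord (d : Plane × ℝ) (i : Fin 2) (p : Plane × ℝ) :
    pd d (fun p => p.1 i) p = d.1 i := by
  have h : HasFDerivAt (fun p : Plane × ℝ => p.1 i)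
      ((EuclideanSpace.proj i : Plane →L[ℝ] ℝ).comp (ContinuousLinearMap.fst ℝ Plane ℝ)) p :=
    ((EuclideanSpace.proj i : Plane →L[ℝ] ℝ).comp
      (ContinuousLinearMap.fst ℝ Plane ℝ)).hasFDerivAt
  simp [pd, h.fderiv]

lemma pd_snd (d : Plane × ℝ) (p : Plane × ℝ) : pd d (fun p => p.2) p = d.2 := by
  have h : HasFDerivAt (fun p : Plane × ℝ => p.2) (ContinuousLinearMap.snd ℝ Plane ℝ) p :=
    hasFDerivAt_snd
  simp [pd, h.fderiv]

lemma energyDensity_eq : energyDensity v = fun p =>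
    (inner ℝ (pd (sdir 0) v p) (pd (sdir 0) v p) + inner ℝ (pd (sdir 1) v p) (pd (sdir 1) v p)
      + inner ℝ (pd tdir v p) (pd tdir v p)) / 2 := by
  ext p
  simp only [energyDensity, Fin.sum_univ_two, real_inner_self_eq_norm_sq]

lemma lagrangian_eq : lagrangian v = fun p =>
    (inner ℝ (pd (sdir 0) v p) (pd (sdir 0) v p) + inner ℝ (pd (sdir 1) v p) (pd (sdir 1) v p)
      - inner ℝ (pd tdir v p) (pd tdir v p)) / 2 := by
  ext p
  simp only [lagrangian, Fin.sum_univ_two, real_inner_self_eq_norm_sq]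

lemma IsNormalWave.differentiableAt_inner (hv : IsNormalWave v R) (d e : Plane × ℝ)
    {p : Plane × ℝ} (hp : p ∈ slab) :
    DifferentiableAt ℝ (fun p => inner ℝ (pd d v p) (pd e v p)) p :=
  (hv.differentiableAt_pd d hp).inner ℝ (hv.differentiableAt_pd e hp)

/-- Pair the wave operator with `∂ₜv`; the nonlinearity drops out by normality. -/
lemma IsNormalWave.energy_law (hv : IsNormalWave v R) {p : Plane × ℝ} (hp : p ∈ slab) :
    pd tdir (energyDensity v) p = ∑ j, pd (sdir j) (momentum v j) p := by
  have hI := fun d e => hv.differentiableAt_inner d e hp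
  have hm : ∀ j, pd (sdir j) (momentum v j) p = _ := fun j => hv.pd_inner (sdir j) _ _ hp
  have hn := hv.normal p hp tdir
  rw [energyDensity_eq, pd_div_const (((hI _ _).fun_add (hI _ _)).fun_add (hI _ _)),
    pd_add ((hI _ _).fun_add (hI _ _)) (hI _ _), pd_add (hI _ _) (hI _ _)]
  simp only [hm, hv.pd_inner _ _ _ hp, Fin.sum_univ_two, hv.pd_comm tdir (sdir _) hp,
    inner_sub_right, inner_add_right] at hn ⊢
  simp only [real_inner_comm (pd tdir v p)] at hn ⊢
  linarith

/-- Pair the wave operator with `∂ᵢv`. -/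
lemma IsNormalWave.momentum_law (hv : IsNormalWave v R) (i : Fin 2) {p : Plane × ℝ}
    (hp : p ∈ slab) :
    pd tdir (momentum v i) p
      = ∑ j, pd (sdir j) (gradGram v i j) p - pd (sdir i) (lagrangian v) p := by
  have hI := fun d e => hv.differentiableAt_inner d e hp
  have hm : pd tdir (momentum v i) p = _ := hv.pd_inner tdir _ _ hp
  have hg : ∀ j, pd (sdir j) (gradGram v i j) p = _ := fun j => hv.pd_inner (sdir j) _ _ hp
  have hn := hv.normal p hp (sdir i)
  rw [lagrangian_eq, pd_div_const (((hI _ _).fun_add (hI _ _)).fun_sub (hI _ _)),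
    pd_sub ((hI _ _).fun_add (hI _ _)) (hI _ _), pd_add (hI _ _) (hI _ _), hm]
  simp only [hg, hv.pd_inner _ _ _ hp, Fin.sum_univ_two, hv.pd_comm tdir (sdir _) hp,
    inner_sub_right, inner_add_right] at hn ⊢
  rw [hv.pd_comm (sdir 0) (sdir i) hp, hv.pd_comm (sdir 1) (sdir i) hp]
  simp only [real_inner_comm (pd (sdir i) v p)] at hn ⊢
  linarith

/-- Combine the energy law with weight `t` and the momentum laws with weights `xᵢ`. Derivatives
falling on the weights leave `E - |∇v|² + 2 L`, the factor `2` being the space dimension, and this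
equals `L`. -/
lemma IsNormalWave.scaling_law (hv : IsNormalWave v R) {p : Plane × ℝ} (hp : p ∈ slab) :
    pd tdir (scalingDensity v) p
      = ∑ j, pd (sdir j) (scalingCurrent v j) p + lagrangian v p := by
  have hs : DifferentiableAt ℝ (fun p : Plane × ℝ => p.2) p := differentiableAt_snd
  have hx : ∀ i : Fin 2, DifferentiableAt ℝ (fun p : Plane × ℝ => p.1 i) p := fun i =>
    (contDiff_coord i).differentiable (by simp) p
  have he : DifferentiableAt ℝ (energyDensity v) p :=
    differentiableAt_of_contDiffOn_slab (n := ∞) (by simp) hv.contDiffOn_energyDensity hp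
  have hl : DifferentiableAt ℝ (lagrangian v) p :=
    differentiableAt_of_contDiffOn_slab (n := ∞) (by simp) hv.contDiffOn_lagrangian hp
  have hm : ∀ j, DifferentiableAt ℝ (momentum v j) p := fun j => hv.differentiableAt_inner _ _ hp
  have hg : ∀ i j, DifferentiableAt ℝ (gradGram v i j) p := fun i j =>
    hv.differentiableAt_inner _ _ hp
  have hD : scalingDensity v = fun p => p.2 * energyDensity v p
      + (p.1 0 * momentum v 0 p + p.1 1 * momentum v 1 p) := by
    ext p
    simp [scalingDensity, Fin.sum_univ_two]
  have hC : ∀ j, scalingCurrent v j = fun p => p.2 * momentum v j p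
      + (p.1 0 * gradGram v 0 j p + p.1 1 * gradGram v 1 j p) - p.1 j * lagrangian v p := by
    intro j
    ext p
    simp [scalingCurrent, Fin.sum_univ_two]
  have hCd : ∀ j d, pd d (scalingCurrent v j) p = d.2 * momentum v j p
      + p.2 * pd d (momentum v j) p + (d.1 0 * gradGram v 0 j p + p.1 0 * pd d (gradGram v 0 j) p
      + (d.1 1 * gradGram v 1 j p + p.1 1 * pd d (gradGram v 1 j) p))
      - (d.1 j * lagrangian v p + p.1 j * pd d (lagrangian v) p) := by
    intro j d
    rw [hC, pd_sub ((hs.fun_mul (hm j)).fun_add (((hx _).fun_mul (hg _ _)).fun_add ((hx _).fun_mul (hg _ _))))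
      ((hx _).fun_mul hl), pd_add (hs.fun_mul (hm j)) (((hx _).fun_mul (hg _ _)).fun_add ((hx _).fun_mul (hg _ _))),
      pd_add ((hx _).fun_mul (hg _ _)) ((hx _).fun_mul (hg _ _)), pd_mul hs (hm j), pd_mul (hx _) hl,
      pd_mul (hx _) (hg _ _), pd_mul (hx _) (hg _ _), pd_snd]
    simp only [pd_coord]
  have hE := hv.energy_law hp
  have hM0 := hv.momentum_law 0 hp
  have hM1 := hv.momentum_law 1 hp
  rw [hD, pd_add (hs.fun_mul he) (((hx _).fun_mul (hm _)).fun_add ((hx _).fun_mul (hm _))),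
    pd_add ((hx _).fun_mul (hm _)) ((hx _).fun_mul (hm _)), pd_mul hs he, pd_mul (hx _) (hm _),
    pd_mul (hx _) (hm _), hE, hM0, hM1]
  simp only [pd_coord, pd_snd, Fin.sum_univ_two, hCd]
  simp [sdir, tdir, energyDensity, lagrangian, gradGram, Fin.sum_univ_two]
  ring

end Laws

/-! ### Pointwise inequalities relative to the light cone. -/

section Pointwise

variable {v : Plane × ℝ → Target} {R : ℝ}

/-- The function `|x|² - t²`, whose zero set is the light cone of the origin. -/
def coneFn (p : Plane × ℝ) : ℝ := ‖p.1‖ ^ 2 - p.2 ^ 2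

lemma contDiff_coneFn : ContDiff ℝ ∞ coneFn :=
  (contDiff_fst.norm_sq ℝ).sub (contDiff_snd.pow 2)

lemma continuous_coneFn : Continuous coneFn := contDiff_coneFn.continuous

lemma pd_coneFn (d p : Plane × ℝ) :
    pd d coneFn p = 2 * (inner ℝ p.1 d.1 - p.2 * d.2) := by
  have h1 : HasFDerivAt (fun p : Plane × ℝ => p.1) (ContinuousLinearMap.fst ℝ Plane ℝ) p :=
    hasFDerivAt_fst
  have h2 : HasFDerivAt (fun p : Plane × ℝ => p.2) (ContinuousLinearMap.snd ℝ Plane ℝ) p :=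
    hasFDerivAt_snd
  have h : HasFDerivAt coneFn _ p := h1.norm_sq.sub (h2.pow 2)
  simp only [pd, h.fderiv]
  simp
  ring

lemma pd_sdir_coneFn (j : Fin 2) (p : Plane × ℝ) : pd (sdir j) coneFn p = 2 * p.1 j := by
  simp [pd_coneFn, sdir, EuclideanSpace.inner_single_right]

lemma pd_tdir_coneFn (p : Plane × ℝ) : pd tdir coneFn p = -2 * p.2 := by
  simp [pd_coneFn, tdir]

lemma norm_fst_sq (p : Plane × ℝ) : ‖p.1‖ ^ 2 = p.1 0 ^ 2 + p.1 1 ^ 2 := by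
  simp [EuclideanSpace.norm_sq_eq, Fin.sum_univ_two]

variable (v) in
/-- The flux of the scaling charge through the level sets of `|x|² - t²`. -/
def scalingFlux (p : Plane × ℝ) : ℝ :=
  p.2 * scalingDensity v p + ∑ j, p.1 j * scalingCurrent v j p

lemma energyDensity_nonneg (p : Plane × ℝ) : 0 ≤ energyDensity v p := by
  unfold energyDensity
  positivity

lemma abs_lagrangian_le (p : Plane × ℝ) : |lagrangian v p| ≤ energyDensity v p := by
  have h1 : 0 ≤ ∑ j, ‖pd (sdir j) v p‖ ^ 2 := by positivity
  have h2 : 0 ≤ ‖pd tdir v p‖ ^ 2 := by positivity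
  rw [abs_le, lagrangian, energyDensity]
  constructor <;> linarith

/-- Cauchy–Schwarz in Lagrange form: the defect is the square of the angular derivative `x₁ ∂₀v - x₀
∂₁v`. -/
lemma norm_radial_sq_le (p : Plane × ℝ) :
    ‖p.1 0 • pd (sdir 0) v p + p.1 1 • pd (sdir 1) v p‖ ^ 2
      ≤ ‖p.1‖ ^ 2 * (‖pd (sdir 0) v p‖ ^ 2 + ‖pd (sdir 1) v p‖ ^ 2) := by
  have h : 0 ≤ ‖p.1 1 • pd (sdir 0) v p - p.1 0 • pd (sdir 1) v p‖ ^ 2 := by positivity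
  rw [norm_fst_sq]
  rw [norm_sub_sq_real] at h
  rw [norm_add_sq_real]
  simp only [norm_smul, mul_pow, inner_smul_left, inner_smul_right, Real.norm_eq_abs, sq_abs,
    conj_trivial] at h ⊢
  linarith

lemma sum_momentum_eq (p : Plane × ℝ) :
    ∑ j, p.1 j * momentum v j p
      = inner ℝ (p.1 0 • pd (sdir 0) v p + p.1 1 • pd (sdir 1) v p) (pd tdir v p) := by
  simp [momentum, Fin.sum_univ_two, inner_add_left, inner_smul_left]

lemma abs_sum_momentum_le (p : Plane × ℝ) :
    |∑ j, p.1 j * momentum v j p| ≤ ‖p.1‖ * energyDensity v p := by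
  rw [sum_momentum_eq]
  refine (abs_real_inner_le_norm _ _).trans ?_
  refine abs_le_of_sq_le_sq' ?_ (mul_nonneg (norm_nonneg _) (energyDensity_nonneg p)) |>.2
  rw [mul_pow, mul_pow]
  refine (mul_le_mul_of_nonneg_right (norm_radial_sq_le p) (sq_nonneg _)).trans ?_
  rw [mul_assoc]
  refine mul_le_mul_of_nonneg_left ?_ (sq_nonneg _)
  rw [energyDensity, Fin.sum_univ_two]
  nlinarith [sq_nonneg (‖pd (sdir 0) v p‖ ^ 2 + ‖pd (sdir 1) v p‖ ^ 2 - ‖pd tdir v p‖ ^ 2)]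

/-- Since `|x · m| ≤ |x| E`, one has `D ≥ (t - |x|) E`, which is nonnegative inside the cone;
outside, `t (|x| - t) ≤ |x|² - t²`. -/
lemma scalingDensity_lower {p : Plane × ℝ} (hp : 0 ≤ p.2) :
    -(max (coneFn p) 0 * energyDensity v p) ≤ p.2 * scalingDensity v p := by
  have h1 := (abs_le.1 (abs_sum_momentum_le (v := v) p)).1
  have hE := energyDensity_nonneg (v := v) p
  have hr := norm_nonneg p.1
  have h2 : (p.2 - ‖p.1‖) * energyDensity v p ≤ scalingDensity v p := by
    rw [scalingDensity]
    linarith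
  have h3 := mul_le_mul_of_nonneg_left h2 hp
  have h4 : -max (coneFn p) 0 ≤ p.2 * (p.2 - ‖p.1‖) := by
    rcases le_total ‖p.1‖ p.2 with h | h
    · have := le_max_right (coneFn p) 0
      nlinarith
    · have := le_max_left (coneFn p) 0
      rw [coneFn] at this ⊢
      nlinarith
  nlinarith [mul_le_mul_of_nonneg_right h4 hE]

/-- The perfect square here is what gives the flux through level sets of `q` a sign up to the term
`q L`, which is small near the cone. -/
lemma scalingFlux_add_eq (p : Plane × ℝ) :
    scalingFlux v p + coneFn p * lagrangian v p
      = ‖p.2 • pd tdir v p + (p.1 0 • pd (sdir 0) v p + p.1 1 • pd (sdir 1) v p)‖ ^ 2 := by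
  rw [norm_add_sq_real, norm_add_sq_real, scalingFlux, coneFn, norm_fst_sq]
  simp only [norm_smul, mul_pow, inner_smul_left, inner_smul_right, Real.norm_eq_abs, sq_abs,
    conj_trivial, inner_add_right, Fin.sum_univ_two, scalingDensity, scalingCurrent, momentum,
    gradGram, energyDensity, lagrangian, real_inner_self_eq_norm_sq]
  rw [real_inner_comm (pd tdir v p) (pd (sdir 0) v p),
    real_inner_comm (pd tdir v p) (pd (sdir 1) v p),
    real_inner_comm (pd (sdir 0) v p) (pd (sdir 1) v p)]
  ring

lemma scalingFlux_add_nonneg (p : Plane × ℝ) :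
    0 ≤ scalingFlux v p + coneFn p * lagrangian v p := by
  rw [scalingFlux_add_eq]
  positivity

/-- Expanding the square, the difference from `2 t D` is `(|x|² - t²) |∇v|²`. It lets the flux
outside the cone be traded for `D`, hence for the energy flux. -/
lemma scalingFlux_add_le (p : Plane × ℝ) :
    scalingFlux v p + coneFn p * lagrangian v p
      ≤ 2 * p.2 * scalingDensity v p + 2 * max (coneFn p) 0 * energyDensity v p := by
  have h1 := norm_radial_sq_le (v := v) p
  have hG : 0 ≤ ‖pd (sdir 0) v p‖ ^ 2 + ‖pd (sdir 1) v p‖ ^ 2 := by positivity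
  have hT : 0 ≤ ‖pd tdir v p‖ ^ 2 := by positivity
  rw [scalingFlux_add_eq, norm_add_sq_real, scalingDensity, sum_momentum_eq, inner_smul_left,
    norm_smul, real_inner_comm, energyDensity, Fin.sum_univ_two]
  simp only [mul_pow, Real.norm_eq_abs, sq_abs, conj_trivial]
  have h2 := mul_le_mul_of_nonneg_right (le_max_left (coneFn p) 0) hG
  have h3 := mul_nonneg (le_max_right (coneFn p) 0) hT
  simp only [coneFn] at h2 h3 ⊢
  nlinarith

end Pointwise

/-! ### One-variable weights in `q = |x|² - t²`. -/

section Weights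

/-- The weight `1 / (1 + (q₋/a)² + (q₊/b)²)`. -/
def bump (a b q : ℝ) : ℝ := (1 + (min q 0 / a) ^ 2 + (max q 0 / b) ^ 2)⁻¹

/-- The derivative of `bump`. -/
def bumpDeriv (a b q : ℝ) : ℝ :=
  -(2 * min q 0 / a ^ 2 + 2 * max q 0 / b ^ 2) * bump a b q ^ 2

/-- The weight that is `1` inside the light cone and `1 / (1 + (q/b)²)` outside. -/
def cutoff (b q : ℝ) : ℝ := (1 + (max q 0 / b) ^ 2)⁻¹

/-- The derivative of `cutoff`. -/
def cutoffDeriv (b q : ℝ) : ℝ := -(2 * max q 0 / b ^ 2) * cutoff b q ^ 2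

lemma hasDerivAt_max_sq (q : ℝ) : HasDerivAt (fun q : ℝ => max q 0 ^ 2) (2 * max q 0) q := by
  rcases lt_trichotomy q 0 with h | rfl | h
  · rw [max_eq_right h.le, mul_zero]
    refine (hasDerivAt_const q (0 : ℝ)).congr_of_eventuallyEq ?_
    filter_upwards [Iio_mem_nhds h] with y hy
    simp [max_eq_right (mem_Iio.1 hy).le]
  · rw [hasDerivAt_iff_isLittleO]
    simp only [sub_zero, max_self, mul_zero, smul_zero, ne_eq, OfNat.ofNat_ne_zero,
      not_false_eq_true, zero_pow]
    -- At the corner the square is `O(y²)`, hence `o(y)`: squaring makes the truncation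
    -- differentiable.
    refine (Asymptotics.IsBigO.of_bound 1 (Eventually.of_forall fun y => ?_)).trans_isLittleO
      (Asymptotics.isLittleO_pow_id one_lt_two)
    have : |max y 0| ≤ |y| := by
      rcases le_total y 0 with h | h <;> simp [h]
    simpa using pow_le_pow_left₀ (abs_nonneg _) this 2
  · rw [max_eq_left h.le]
    refine HasDerivAt.congr_of_eventuallyEq (f := fun q => q ^ 2) (by
      simpa using hasDerivAt_pow 2 q) ?_
    filter_upwards [Ioi_mem_nhds h] with y hy
    simp [max_eq_left (mem_Ioi.1 hy).le]

lemma hasDerivAt_min_sq (q : ℝ) : HasDerivAt (fun q : ℝ => min q 0 ^ 2) (2 * min q 0) q := by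
  have h := (hasDerivAt_max_sq (-q)).comp q (hasDerivAt_neg q)
  have e : ∀ y : ℝ, max (-y) 0 = -min y 0 := fun y => by rw [← max_neg_neg, neg_zero]
  simp only [e, Function.comp_def, neg_sq] at h
  exact h.congr_deriv (by ring)

lemma bump_pos (a b q : ℝ) : 0 < bump a b q := by
  unfold bump
  positivity

lemma cutoff_pos (b q : ℝ) : 0 < cutoff b q := by
  unfold cutoff
  positivity

lemma bump_le_one (a b q : ℝ) : bump a b q ≤ 1 := by
  unfold bump
  refine inv_le_one_of_one_le₀ ?_
  nlinarith [sq_nonneg (min q 0 / a), sq_nonneg (max q 0 / b)]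

lemma cutoff_le_one (b q : ℝ) : cutoff b q ≤ 1 := by
  unfold cutoff
  refine inv_le_one_of_one_le₀ ?_
  nlinarith [sq_nonneg (max q 0 / b)]

lemma continuous_bump (a b : ℝ) : Continuous (bump a b) := by
  unfold bump
  refine Continuous.inv₀ (by fun_prop) fun q => ?_
  positivity

lemma continuous_cutoff (b : ℝ) : Continuous (cutoff b) := by
  unfold cutoff
  refine Continuous.inv₀ (by fun_prop) fun q => ?_
  positivity

lemma continuous_bumpDeriv (a b : ℝ) : Continuous (bumpDeriv a b) := by
  have := continuous_bump a b
  unfold bumpDeriv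
  fun_prop

lemma continuous_cutoffDeriv (b : ℝ) : Continuous (cutoffDeriv b) := by
  have := continuous_cutoff b
  unfold cutoffDeriv
  fun_prop

lemma hasDerivAt_bump (a b q : ℝ) : HasDerivAt (bump a b) (bumpDeriv a b q) q := by
  have h : HasDerivAt (fun q : ℝ => 1 + (min q 0 / a) ^ 2 + (max q 0 / b) ^ 2)
      (2 * min q 0 / a ^ 2 + 2 * max q 0 / b ^ 2) q := by
    simp only [div_pow]
    exact (((hasDerivAt_min_sq q).div_const _).const_add 1).add
      ((hasDerivAt_max_sq q).div_const _)
  have h2 := h.fun_inv (by positivity)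
  refine h2.congr_deriv ?_
  simp only [bumpDeriv, bump]
  field_simp

lemma hasDerivAt_cutoff (b q : ℝ) : HasDerivAt (cutoff b) (cutoffDeriv b q) q := by
  have h : HasDerivAt (fun q : ℝ => 1 + (max q 0 / b) ^ 2) (2 * max q 0 / b ^ 2) q := by
    simp only [div_pow]
    exact ((hasDerivAt_max_sq q).div_const _).const_add 1
  have h2 := h.fun_inv (by positivity)
  refine h2.congr_deriv ?_
  simp only [cutoffDeriv, cutoff]
  field_simp

lemma cutoffDeriv_nonpos (b q : ℝ) : cutoffDeriv b q ≤ 0 := by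
  have : 0 ≤ 2 * max q 0 / b ^ 2 * cutoff b q ^ 2 := by positivity
  rw [cutoffDeriv]
  linarith

lemma bump_of_nonneg (a b : ℝ) {q : ℝ} (hq : 0 ≤ q) : bump a b q = cutoff b q := by
  simp [bump, cutoff, hq]

lemma bumpDeriv_of_nonneg (a b : ℝ) {q : ℝ} (hq : 0 ≤ q) :
    bumpDeriv a b q = cutoffDeriv b q := by
  simp [bumpDeriv, cutoffDeriv, hq, bump_of_nonneg]

lemma cutoff_of_nonpos (b : ℝ) {q : ℝ} (hq : q ≤ 0) : cutoff b q = 1 := by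
  simp [cutoff, hq]

lemma cutoffDeriv_of_nonpos (b : ℝ) {q : ℝ} (hq : q ≤ 0) : cutoffDeriv b q = 0 := by
  simp [cutoffDeriv, hq]

lemma bump_of_nonpos (a b : ℝ) {q : ℝ} (hq : q ≤ 0) : bump a b q = bump a a q := by
  simp [bump, hq]

lemma bump_self (a q : ℝ) : bump a a q = (1 + (q / a) ^ 2)⁻¹ := by
  rcases le_total q 0 with h | h <;> simp [bump, h]

lemma bumpDeriv_of_nonpos (a b : ℝ) {q : ℝ} (hq : q ≤ 0) :
    bumpDeriv a b q = -(2 * q / a ^ 2) * bump a b q ^ 2 := by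
  simp [bumpDeriv, hq]

lemma bumpDeriv_nonneg_of_nonpos (a b : ℝ) {q : ℝ} (hq : q ≤ 0) : 0 ≤ bumpDeriv a b q := by
  rw [bumpDeriv_of_nonpos a b hq]
  refine mul_nonneg ?_ (sq_nonneg _)
  have : 2 * q / a ^ 2 ≤ 0 := div_nonpos_of_nonpos_of_nonneg (by linarith) (sq_nonneg _)
  linarith

/-- This is `(1 - s²)² ≥ 0`. With `s = q / width` it bounds `|q k'(q)|` independently of the width.
-/
lemma two_mul_sq_mul_inv_sq_le (s : ℝ) : 2 * s ^ 2 * ((1 + s ^ 2)⁻¹) ^ 2 ≤ 1 / 2 := by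
  rw [inv_pow, ← div_eq_mul_inv, div_le_div_iff₀ (by positivity) (by norm_num)]
  nlinarith [sq_nonneg (1 - s ^ 2)]

lemma neg_mul_bumpDeriv_le (a b : ℝ) {q : ℝ} (hq : q ≤ 0) :
    -q * bumpDeriv a b q ≤ 1 / 2 := by
  rw [bumpDeriv_of_nonpos a b hq, bump_of_nonpos a b hq, bump_self]
  refine le_trans (le_of_eq ?_) (two_mul_sq_mul_inv_sq_le (q / a))
  ring

/-- `max q 0 * |cutoffDeriv b q|`, the weight of the error terms outside the light cone. -/
def cutoffError (b q : ℝ) : ℝ := -(max q 0 * cutoffDeriv b q)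

lemma continuous_cutoffError (b : ℝ) : Continuous (cutoffError b) := by
  have := continuous_cutoffDeriv b
  unfold cutoffError
  fun_prop

lemma cutoffError_eq (b q : ℝ) :
    cutoffError b q = 2 * (max q 0 / b) ^ 2 * ((1 + (max q 0 / b) ^ 2)⁻¹) ^ 2 := by
  rw [cutoffError, cutoffDeriv, cutoff]
  ring

lemma cutoffError_nonneg (b q : ℝ) : 0 ≤ cutoffError b q := by
  rw [cutoffError_eq]
  positivity

lemma cutoffError_le (b q : ℝ) : cutoffError b q ≤ 1 / 2 := by
  rw [cutoffError_eq]
  exact two_mul_sq_mul_inv_sq_le _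

lemma mul_bump_self_le {a q : ℝ} (ha : 0 < a) : q * bump a a q ≤ a / 2 := by
  rw [bump_self, ← div_eq_mul_inv, div_le_div_iff₀ (by positivity) (by norm_num)]
  have h : a * (1 + (q / a) ^ 2) - 2 * q = a * (1 - q / a) ^ 2 := by
    field_simp
    ring
  nlinarith [mul_nonneg ha.le (sq_nonneg (1 - q / a))]

lemma cutoff_eq_bump_self (b : ℝ) {q : ℝ} (hq : 0 ≤ q) : cutoff b q = bump b b q :=
  (bump_of_nonneg b b hq).symm

lemma cutoff_le_bump_self {a b q : ℝ} (hb : 0 < b) (hba : b ≤ a) (hq : 0 ≤ q) :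
    cutoff b q ≤ bump a a q := by
  rw [bump_self, cutoff, max_eq_left hq]
  have : 0 ≤ q / a := div_nonneg hq (hb.le.trans hba)
  gcongr

lemma tendsto_div_sq_atTop {q : ℝ} (hq : 0 < q) :
    Tendsto (fun b : ℝ => (q / b) ^ 2) (𝓝[>] 0) atTop := by
  refine (tendsto_pow_atTop two_ne_zero).comp ?_
  exact tendsto_inv_nhdsGT_zero.const_mul_atTop hq

lemma tendsto_cutoff (q : ℝ) :
    Tendsto (fun b => cutoff b q) (𝓝[>] 0) (𝓝 (if q ≤ 0 then 1 else 0)) := by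
  split_ifs with h
  · simp [cutoff_of_nonpos _ h]
  · push Not at h
    simp only [cutoff, max_eq_left h.le]
    exact tendsto_inv_atTop_zero.comp
      (tendsto_atTop_add_const_left _ 1 (tendsto_div_sq_atTop h))

/-- Although `cutoffError b` is only bounded uniformly in `b`, it vanishes for `q ≤ 0` and is at
most `2 * cutoff b q` for `q > 0`, so it tends to zero pointwise and dominated convergence applies.
-/
lemma tendsto_cutoffError (q : ℝ) : Tendsto (fun b => cutoffError b q) (𝓝[>] 0) (𝓝 0) := by
  rcases le_or_gt q 0 with h | h
  · simp [cutoffError, h]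
  · have h1 : Tendsto (fun b => 2 * cutoff b q) (𝓝[>] 0) (𝓝 0) := by
      have := (tendsto_cutoff q).const_mul 2
      simpa [not_le.2 h] using this
    refine squeeze_zero (fun b => cutoffError_nonneg b q) (fun b => ?_) h1
    rw [cutoffError_eq, cutoff]
    set s := (max q 0 / b) ^ 2
    have hs : 0 ≤ s := sq_nonneg _
    have : s * (1 + s)⁻¹ ≤ 1 := by
      rw [← div_eq_mul_inv, div_le_one (by positivity)]
      linarith
    have h2 : 0 ≤ (1 + s)⁻¹ := by positivity
    nlinarith [mul_le_mul_of_nonneg_right this h2]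

end Weights

/-! ### Weighted energy and scaling identities, and the integrand estimate. -/

section Estimates

variable {v : Plane × ℝ → Target} {R : ℝ}

/-- The balance law tested with the weight `(A t + B) k(|x|² - t²)`. -/
lemma cone_balance {Q g : Plane × ℝ → ℝ} {Y : Fin 2 → Plane × ℝ → ℝ}
    (hQ : ContDiffOn ℝ 1 Q slab) (hY : ∀ j, ContDiffOn ℝ 1 (Y j) slab)
    (hQR : VanishesOutside R Q) (hYR : ∀ j, VanishesOutside R (Y j))
    (law : ∀ p ∈ slab, pd tdir Q p = ∑ j, pd (sdir j) (Y j) p + g p)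
    {k k' : ℝ → ℝ} (hk : ∀ q, HasDerivAt k (k' q) q) (hk' : Continuous k') (A B : ℝ)
    {s τ : ℝ} (hs : 0 < s) (hsτ : s ≤ τ) (hτ : τ < 1) :
    (∫ x, (A * τ + B) * k (coneFn (x, τ)) * Q (x, τ))
        - ∫ x, (A * s + B) * k (coneFn (x, s)) * Q (x, s)
      = ∫ p in (univ : Set Plane) ×ˢ Ioc s τ,
          ((A * p.2 + B) * (-2 * k' (coneFn p) * (p.2 * Q p + ∑ j, p.1 j * Y j p))
            + A * k (coneFn p) * Q p + (A * p.2 + B) * k (coneFn p) * g p) := by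
  have hkc : ContDiff ℝ 1 k := by
    rw [contDiff_one_iff_deriv]
    refine ⟨fun q => (hk q).differentiableAt, ?_⟩
    rwa [funext fun q => (hk q).deriv]
  have hα : ContDiff ℝ 1 fun p : Plane × ℝ => A * p.2 + B := by fun_prop
  have hkq : ContDiff ℝ 1 fun p : Plane × ℝ => k (coneFn p) :=
    hkc.comp (contDiff_coneFn.of_le (by simp))
  have hpk : ∀ d p, pd d (fun p : Plane × ℝ => k (coneFn p)) p = k' (coneFn p) * pd d coneFn p := by
    intro d p
    have h := (hk (coneFn p)).comp_hasFDerivAt p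
      (contDiff_coneFn.differentiable (by simp) p).hasFDerivAt
    have h' : HasFDerivAt (fun p : Plane × ℝ => k (coneFn p)) _ p := h
    simp [pd, h'.fderiv]
  have hpα : ∀ d p, pd d (fun p : Plane × ℝ => A * p.2 + B) p = A * d.2 := by
    intro d p
    have h0 : HasFDerivAt (fun p : Plane × ℝ => p.2) (ContinuousLinearMap.snd ℝ Plane ℝ) p :=
      hasFDerivAt_snd
    have h : HasFDerivAt (fun p : Plane × ℝ => A * p.2 + B) _ p := (h0.const_mul A).add_const B
    simp [pd, h.fderiv]
  have hw := weighted_balance hQ hY (hα.mul hkq) hQR hYR law hs hsτ hτ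
  refine hw.trans (integral_congr_ae (Eventually.of_forall fun p => ?_))
  have hd := fun d => pd_mul (hα.differentiable one_ne_zero p) (hkq.differentiable one_ne_zero p) d
  simp only [hd, hpk, hpα, pd_sdir_coneFn, pd_tdir_coneFn, Fin.sum_univ_two]
  simp only [tdir, sdir]
  ring

/-- The energy identity with weight `k(|x|² - t²)`. -/
lemma IsNormalWave.energy_balance (hv : IsNormalWave v R) {k k' : ℝ → ℝ}
    (hk : ∀ q, HasDerivAt k (k' q) q) (hk' : Continuous k')
    {s τ : ℝ} (hs : 0 < s) (hsτ : s ≤ τ) (hτ : τ < 1) :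
    (∫ x, k (coneFn (x, τ)) * energyDensity v (x, τ))
        - ∫ x, k (coneFn (x, s)) * energyDensity v (x, s)
      = ∫ p in (univ : Set Plane) ×ˢ Ioc s τ, -2 * k' (coneFn p) * scalingDensity v p := by
  have h := cone_balance (Q := energyDensity v) (Y := momentum v) (g := fun _ => 0)
    (hv.contDiffOn_energyDensity.of_le (by simp))
    (fun j => (hv.contDiffOn_inner _ _).of_le (by simp)) hv.vanishes_energyDensity
    hv.vanishes_momentum (fun p hp => by rw [hv.energy_law hp, add_zero]) hk hk' 0 1 hs hsτ hτ
  simpa [scalingDensity] using h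

/-- The identity for the scaling field with weight `(t - s) k(|x|² - t²)`. -/
lemma IsNormalWave.scaling_balance (hv : IsNormalWave v R) {k k' : ℝ → ℝ}
    (hk : ∀ q, HasDerivAt k (k' q) q) (hk' : Continuous k')
    {s τ : ℝ} (hs : 0 < s) (hsτ : s ≤ τ) (hτ : τ < 1) :
    (τ - s) * ∫ x, k (coneFn (x, τ)) * scalingDensity v (x, τ)
      = ∫ p in (univ : Set Plane) ×ˢ Ioc s τ,
          ((p.2 - s) * (-2 * k' (coneFn p) * scalingFlux v p)
            + k (coneFn p) * scalingDensity v p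
            + (p.2 - s) * k (coneFn p) * lagrangian v p) := by
  have h := cone_balance (Q := scalingDensity v) (Y := scalingCurrent v) (g := lagrangian v)
    (hv.contDiffOn_scalingDensity.of_le (by simp))
    (fun j => (hv.contDiffOn_scalingCurrent j).of_le (by simp)) hv.vanishes_scalingDensity
    hv.vanishes_scalingCurrent (fun p hp => hv.scaling_law hp) hk hk' 1 (-s) hs hsτ hτ
  -- The time weight `t - s` vanishes at `t = s`, so only the boundary term at `τ` survives.
  simp only [one_mul, ← sub_eq_add_neg, sub_self, zero_mul, integral_zero, sub_zero, mul_assoc,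
    integral_const_mul] at h ⊢
  exact h

lemma IsNormalWave.energy_conserved (hv : IsNormalWave v R) {s τ : ℝ} (hs : 0 < s)
    (hsτ : s ≤ τ) (hτ : τ < 1) :
    ∫ x, energyDensity v (x, τ) = ∫ x, energyDensity v (x, s) := by
  have h := hv.energy_balance (k := fun _ => 1) (k' := fun _ => 0)
    (fun q => hasDerivAt_const q 1) continuous_const hs hsτ hτ
  simpa [sub_eq_zero] using h

/-- Each term on the right has a controllable integral: the first by the arctangent weight, the
second is the change of `cutoffEnergy`, the third is a multiple of the conserved energy, and the
last vanishes as `b → 0`. -/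
lemma scaling_integrand_le {p : Plane × ℝ} {s τ a b : ℝ} (hs : 0 < s) (hsp : s ≤ p.2)
    (hpτ : p.2 ≤ τ) (hτs : τ ≤ 2 * s) (hb : 0 < b) (hba : b ≤ a) :
    (p.2 - s) * (-2 * bumpDeriv a b (coneFn p) * scalingFlux v p)
        + bump a b (coneFn p) * scalingDensity v p
        + (p.2 - s) * bump a b (coneFn p) * lagrangian v p
      ≤ bump a a (coneFn p) * scalingDensity v p
        + 2 * τ * (τ - s) * (-2 * cutoffDeriv b (coneFn p) * scalingDensity v p)
        + (a / s + 2 * (τ - s)) * energyDensity v p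
        + 10 * (τ - s) * (cutoffError b (coneFn p) * energyDensity v p) := by
  have ht : 0 < p.2 := hs.trans_le hsp
  have ha : 0 < a := hb.trans_le hba
  have hE := energyDensity_nonneg (v := v) p
  have hL := abs_le.1 (abs_lagrangian_le (v := v) p)
  have hD := scalingDensity_lower (v := v) ht.le
  have hM0 := scalingFlux_add_nonneg (v := v) p
  have hM1 := scalingFlux_add_le (v := v) p
  have hφ0 := (bump_pos a b (coneFn p)).le
  have hφ1 := bump_le_one a b (coneFn p)
  set q := coneFn p
  set E := energyDensity v p
  set L := lagrangian v p
  set D := scalingDensity v p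
  set M := scalingFlux v p
  set t := p.2
  have hT : 0 ≤ τ - s := by linarith
  have hα0 : 0 ≤ t - s := by linarith
  have hα1 : t - s ≤ τ - s := by linarith
  have hL1 : (t - s) * bump a b q * L ≤ (τ - s) * E := by
    calc (t - s) * bump a b q * L ≤ (t - s) * bump a b q * E :=
          mul_le_mul_of_nonneg_left hL.2 (mul_nonneg hα0 hφ0)
      _ ≤ (τ - s) * 1 * E := by gcongr
      _ = (τ - s) * E := by ring
  have has : 0 ≤ a / s * E := by positivity
  rcases le_total q 0 with hq | hq
  · have h1 : -2 * bumpDeriv a b q * M ≤ E := by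
      have h2 := bumpDeriv_nonneg_of_nonpos a b hq
      have h3 := neg_mul_bumpDeriv_le a b hq
      -- Inside the cone `M ≥ -q L` and `|L| ≤ E`; the weight satisfies `-q k' ≤ 1/2`.
      have h4 : -(-q * E) ≤ M := by nlinarith
      nlinarith [mul_le_mul_of_nonneg_left h4 h2, mul_le_mul_of_nonneg_right h3 hE]
    have h2 : (t - s) * (-2 * bumpDeriv a b q * M) ≤ (τ - s) * E :=
      (mul_le_mul_of_nonneg_left h1 hα0).trans (mul_le_mul_of_nonneg_right hα1 hE)
    rw [cutoffDeriv_of_nonpos b hq, bump_of_nonpos a b hq, cutoffError, max_eq_right hq]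
    rw [bump_of_nonpos a b hq] at hL1
    linarith
  · rw [max_eq_left hq] at hD hM1
    have hc : 0 ≤ -cutoffDeriv b q := by linarith [cutoffDeriv_nonpos b q]
    have hqE : 0 ≤ q * E := mul_nonneg hq hE
    have h1 : M ≤ 2 * (t * D) + 3 * (q * E) := by nlinarith
    -- `D` may be negative, so replacing `t` by `τ` costs an error; `τ ≤ 2 s` gives `τ - t ≤ t`,
    -- which keeps it below `q E`.
    have h2 : t * D ≤ τ * D + q * E := by
      have h3 : (τ - t) * (t * D) ≥ -((τ - t) * (q * E)) := by
        nlinarith [mul_le_mul_of_nonneg_left hD (sub_nonneg.2 hpτ)]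
      have h4 : (τ - t) * (q * E) ≤ t * (q * E) :=
        mul_le_mul_of_nonneg_right (by linarith) hqE
      have h5 : 0 ≤ t * ((τ - t) * D + q * E) := by nlinarith
      have h6 := nonneg_of_mul_nonneg_right h5 ht
      linarith
    have h3 : (t - s) * (-2 * cutoffDeriv b q * M)
        ≤ 2 * τ * (τ - s) * (-2 * cutoffDeriv b q * D)
          + 10 * (τ - s) * (-(q * cutoffDeriv b q) * E) := by
      calc (t - s) * (-2 * cutoffDeriv b q * M)
          = 2 * (-cutoffDeriv b q) * ((t - s) * M) := by ring
        _ ≤ 2 * (-cutoffDeriv b q) * ((τ - s) * (2 * τ * D + 5 * (q * E))) := by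
            refine mul_le_mul_of_nonneg_left ?_ (by linarith)
            calc (t - s) * M ≤ (t - s) * (2 * (t * D) + 3 * (q * E)) :=
                  mul_le_mul_of_nonneg_left h1 hα0
              -- Enlarging the time weight is allowed because `t D ≥ -q E` makes the bracket
              -- nonnegative.
              _ ≤ (τ - s) * (2 * (t * D) + 3 * (q * E)) :=
                  mul_le_mul_of_nonneg_right hα1 (by linarith)
              _ ≤ (τ - s) * (2 * τ * D + 5 * (q * E)) :=
                  mul_le_mul_of_nonneg_left (by linarith) hT
        _ = _ := by ring
    -- Widening the outer profile from `b` to `a` loses only through negative values of `D`, where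
    -- `t D ≥ -q E` and `q * bump a a q ≤ a / 2`.
    have h4 : cutoff b q * D ≤ bump a a q * D + a / s * E := by
      have h5 := cutoff_le_bump_self hb hba hq
      have h6 := (cutoff_pos b q).le
      have h7 := mul_bump_self_le (q := q) ha
      have h8 : -(a * E) ≤ t * ((bump a a q - cutoff b q) * D) := by
        have h9 := mul_le_mul_of_nonneg_left hD (sub_nonneg.2 h5)
        have h10 := mul_le_mul_of_nonneg_right h7 hE
        have h11 := mul_nonneg h6 hqE
        have h12 := mul_nonneg ha.le hE
        nlinarith
      have h9 : a / t * E ≤ a / s * E := by gcongr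
      have h10 : 0 ≤ t * ((bump a a q - cutoff b q) * D + a / t * E) := by
        have : t * (a / t * E) = a * E := by field_simp
        rw [mul_add, this]
        linarith
      have h11 := nonneg_of_mul_nonneg_right h10 ht
      linarith
    rw [bump_of_nonneg a b hq, bumpDeriv_of_nonneg a b hq, cutoffError, max_eq_left hq]
    rw [bump_of_nonneg a b hq] at hL1
    have := mul_nonneg hT hE
    linarith

end Estimates

/-! ### Integrated estimates, the limit `b → 0`, and monotonicity of the energy in the cone. -/

section Estimates

variable {v : Plane × ℝ → Target} {R : ℝ}

variable (v) in
/-- The total energy, which is the same at all times. -/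
def totalEnergy : ℝ := ∫ x, energyDensity v (x, 1 / 2)

variable (v) in
/-- The energy at time `t` with the weight `cutoff b`. -/
def cutoffEnergy (b t : ℝ) : ℝ := ∫ x, cutoff b (coneFn (x, t)) * energyDensity v (x, t)

variable (v) in
/-- The energy at time `t` inside the light cone of the origin. -/
def coneEnergy (t : ℝ) : ℝ :=
  ∫ x, (if coneFn (x, t) ≤ 0 then 1 else 0) * energyDensity v (x, t)

variable (v) in
/-- The space-time integral of the energy density with the weight `cutoffError b`. -/
def errorIntegral (b s τ : ℝ) : ℝ :=
  ∫ p in (univ : Set Plane) ×ˢ Ioc s τ, cutoffError b (coneFn p) * energyDensity v p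

lemma IsNormalWave.integral_energyDensity (hv : IsNormalWave v R) {t : ℝ} (h0 : 0 < t)
    (h1 : t < 1) : ∫ x, energyDensity v (x, t) = totalEnergy v := by
  rcases le_total t (1 / 2) with h | h
  · exact (hv.energy_conserved h0 h (by norm_num)).symm
  · exact hv.energy_conserved (by norm_num) h h1

lemma IsNormalWave.continuousOn_energyDensity (hv : IsNormalWave v R) :
    ContinuousOn (energyDensity v) slab := hv.contDiffOn_energyDensity.continuousOn

lemma IsNormalWave.continuousOn_scalingDensity (hv : IsNormalWave v R) :
    ContinuousOn (scalingDensity v) slab := hv.contDiffOn_scalingDensity.continuousOn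

lemma VanishesOutside.mul_left {f : Plane × ℝ → ℝ} (hf : VanishesOutside R f)
    (g : Plane × ℝ → ℝ) : VanishesOutside R fun p => g p * f p := fun p hp h => by
  simp [hf p hp h]

lemma integrableOn_strip_mul {f : Plane × ℝ → ℝ} (hf : ContinuousOn f slab)
    (hR : VanishesOutside R f) {k : ℝ → ℝ} (hk : Continuous k) {s τ : ℝ} (hs : 0 < s)
    (hτ : τ < 1) :
    IntegrableOn (fun p => k (coneFn p) * f p) ((univ : Set Plane) ×ˢ Ioc s τ) :=
  integrableOn_strip ((hk.comp continuous_coneFn).continuousOn.mul hf) (hR.mul_left _) hs hτ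

lemma integrable_slice_mul {f : Plane × ℝ → ℝ} (hf : ContinuousOn f slab)
    (hR : VanishesOutside R f) {k : ℝ → ℝ} (hk : Continuous k) {t : ℝ} (h0 : 0 < t)
    (h1 : t < 1) : Integrable fun x => k (coneFn (x, t)) * f (x, t) :=
  integrable_slice (f := fun p => k (coneFn p) * f p)
    ((hk.comp continuous_coneFn).continuousOn.mul hf) (hR.mul_left _) h0 h1

lemma IsNormalWave.integral_strip_energyDensity (hv : IsNormalWave v R) {s τ : ℝ} (hs : 0 < s)
    (hsτ : s ≤ τ) (hτ : τ < 1) :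
    ∫ p in (univ : Set Plane) ×ˢ Ioc s τ, energyDensity v p = (τ - s) * totalEnergy v := by
  have hi := integrableOn_strip hv.continuousOn_energyDensity hv.vanishes_energyDensity hs hτ
  rw [IntegrableOn, volume_restrict_strip] at hi
  rw [volume_restrict_strip, integral_prod_symm _ hi,
    setIntegral_congr_fun measurableSet_Ioc (g := fun _ => totalEnergy v) fun t ht =>
      hv.integral_energyDensity (hs.trans ht.1) (ht.2.trans_lt hτ)]
  simp [hsτ]

lemma totalEnergy_nonneg : 0 ≤ totalEnergy v :=
  integral_nonneg fun _ => energyDensity_nonneg _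

/-- The constants make `-2 k' = bump a a` while `|k| ≤ a π / 4`, so the energy balance bounds the
integral of `bump a a` times `D` by boundary terms of size `a`. -/
lemma hasDerivAt_arctan_weight {a : ℝ} (ha : 0 < a) (q : ℝ) :
    HasDerivAt (fun q => -(a / 2) * Real.arctan (q / a)) (-(1 / 2) * bump a a q) q := by
  refine ((((hasDerivAt_id q).div_const a).arctan).const_mul (-(a / 2))).congr_deriv ?_
  rw [bump_self]
  simp only [id]
  field_simp

/-- The scaling density near the light cone, integrated over time. -/
lemma IsNormalWave.integral_bump_scalingDensity_le (hv : IsNormalWave v R) {a s τ : ℝ}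
    (ha : 0 < a) (hs : 0 < s) (hsτ : s ≤ τ) (hτ : τ < 1) :
    ∫ p in (univ : Set Plane) ×ˢ Ioc s τ, bump a a (coneFn p) * scalingDensity v p
      ≤ a / 2 * Real.pi * totalEnergy v := by
  have hψ : Continuous fun q : ℝ => -(a / 2) * Real.arctan (q / a) :=
    continuous_const.mul (Real.continuous_arctan.comp (continuous_id.div_const a))
  have h := hv.energy_balance (hasDerivAt_arctan_weight ha)
    (continuous_const.mul (continuous_bump a a)) hs hsτ hτ
  have e : (fun p => -2 * (-(1 / 2) * bump a a (coneFn p)) * scalingDensity v p)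
      = fun p => bump a a (coneFn p) * scalingDensity v p := by
    ext p
    ring
  rw [e] at h
  rw [← h]
  have key : ∀ t, 0 < t → t < 1 →
      |∫ x, -(a / 2) * Real.arctan (coneFn (x, t) / a) * energyDensity v (x, t)|
        ≤ a / 2 * (Real.pi / 2) * totalEnergy v := by
    intro t h0 h1
    rw [← hv.integral_energyDensity h0 h1, ← integral_const_mul]
    refine (abs_integral_le_integral_abs).trans (integral_mono_of_nonneg
      (Eventually.of_forall fun x => abs_nonneg _)
      ((integrable_slice hv.continuousOn_energyDensity hv.vanishes_energyDensity h0 h1).const_mul _)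
      (Eventually.of_forall fun x => ?_))
    simp only [abs_mul, abs_of_nonneg (energyDensity_nonneg (v := v) (x, t)), abs_neg,
      abs_of_pos (half_pos ha)]
    have : |Real.arctan (coneFn (x, t) / a)| ≤ Real.pi / 2 :=
      abs_le.2 ⟨(Real.neg_pi_div_two_lt_arctan _).le, (Real.arctan_lt_pi_div_two _).le⟩
    have := energyDensity_nonneg (v := v) (x, t)
    gcongr
  have h1 := (abs_le.1 (key τ (hs.trans_le hsτ) hτ)).2
  have h2 := (abs_le.1 (key s hs (hsτ.trans_lt hτ))).1
  linarith

lemma IsNormalWave.cutoffEnergy_sub (hv : IsNormalWave v R) (b : ℝ) {s τ : ℝ} (hs : 0 < s)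
    (hsτ : s ≤ τ) (hτ : τ < 1) :
    cutoffEnergy v b τ - cutoffEnergy v b s
      = ∫ p in (univ : Set Plane) ×ˢ Ioc s τ,
          -2 * cutoffDeriv b (coneFn p) * scalingDensity v p :=
  hv.energy_balance (hasDerivAt_cutoff b) (continuous_cutoffDeriv b) hs hsτ hτ

/-- The main estimate: the scaling density near the light cone at time `τ`. -/
lemma IsNormalWave.bump_scalingDensity_le (hv : IsNormalWave v R) {a b s τ : ℝ}
    (hb : 0 < b) (hba : b ≤ a) (hs : 0 < s) (hsτ : s ≤ τ) (hτs : τ ≤ 2 * s) (hτ : τ < 1) :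
    (τ - s) * ∫ x, bump a b (coneFn (x, τ)) * scalingDensity v (x, τ)
      ≤ a / 2 * Real.pi * totalEnergy v
        + 2 * τ * (τ - s) * (cutoffEnergy v b τ - cutoffEnergy v b s)
        + (a / s + 2 * (τ - s)) * ((τ - s) * totalEnergy v)
        + 10 * (τ - s) * errorIntegral v b s τ := by
  have i1 := integrableOn_strip_mul hv.continuousOn_scalingDensity hv.vanishes_scalingDensity
    (continuous_bump a a) hs hτ
  have i2 := (integrableOn_strip_mul hv.continuousOn_scalingDensity hv.vanishes_scalingDensity
    (k := fun q => -2 * cutoffDeriv b q)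
    (continuous_const.mul (continuous_cutoffDeriv b)) hs hτ).const_mul (2 * τ * (τ - s))
  have i3 := (integrableOn_strip hv.continuousOn_energyDensity hv.vanishes_energyDensity
    hs hτ).const_mul (a / s + 2 * (τ - s))
  have i4 := (integrableOn_strip_mul hv.continuousOn_energyDensity hv.vanishes_energyDensity
    (continuous_cutoffError b) hs hτ).const_mul (10 * (τ - s))
  have hI := ((i1.add i2).add i3).add i4
  have hflux : ContinuousOn (scalingFlux v) slab :=
    (continuous_snd.continuousOn.mul hv.continuousOn_scalingDensity).add
      (continuousOn_finsetSum _ fun j _ => (contDiff_coord j).continuous.continuousOn.mul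
        (hv.contDiffOn_scalingCurrent j).continuousOn)
  have hfluxR : VanishesOutside R (scalingFlux v) := fun p hp h => by
    simp [scalingFlux, hv.vanishes_scalingDensity p hp h, hv.vanishes_scalingCurrent _ p hp h]
  have c1 : Continuous fun p : Plane × ℝ => p.2 - s := by fun_prop
  have c2 : Continuous fun p => bump a b (coneFn p) := (continuous_bump a b).comp continuous_coneFn
  have c3 : Continuous fun p => -2 * bumpDeriv a b (coneFn p) :=
    continuous_const.mul ((continuous_bumpDeriv a b).comp continuous_coneFn)
  have hJ : IntegrableOn (fun p : Plane × ℝ =>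
      (p.2 - s) * (-2 * bumpDeriv a b (coneFn p) * scalingFlux v p)
        + bump a b (coneFn p) * scalingDensity v p
        + (p.2 - s) * bump a b (coneFn p) * lagrangian v p)
      ((univ : Set Plane) ×ˢ Ioc s τ) := by
    refine integrableOn_strip (R := R) ?_ ?_ hs hτ
    · exact ((c1.continuousOn.mul (c3.continuousOn.mul hflux)).add
        (c2.continuousOn.mul hv.continuousOn_scalingDensity)).add
        ((c1.mul c2).continuousOn.mul hv.contDiffOn_lagrangian.continuousOn)
    · intro p hp h
      simp [hfluxR p hp h, hv.vanishes_scalingDensity p hp h, hv.vanishes_lagrangian p hp h]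
  rw [hv.scaling_balance (hasDerivAt_bump a b) (continuous_bumpDeriv a b) hs hsτ hτ]
  refine (setIntegral_mono_on hJ hI (measurableSet_strip s τ) fun p hp =>
    scaling_integrand_le hs hp.2.1.le hp.2.2 hτs hb hba).trans ?_
  have e : ∀ f1 f2 f3 f4 : Plane × ℝ → ℝ,
      IntegrableOn f1 ((univ : Set Plane) ×ˢ Ioc s τ) →
      IntegrableOn f2 ((univ : Set Plane) ×ˢ Ioc s τ) →
      IntegrableOn f3 ((univ : Set Plane) ×ˢ Ioc s τ) →
      IntegrableOn f4 ((univ : Set Plane) ×ˢ Ioc s τ) →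
      ∫ p in (univ : Set Plane) ×ˢ Ioc s τ, (f1 + f2 + f3 + f4) p
        = (∫ p in (univ : Set Plane) ×ˢ Ioc s τ, f1 p)
          + (∫ p in (univ : Set Plane) ×ˢ Ioc s τ, f2 p)
          + (∫ p in (univ : Set Plane) ×ˢ Ioc s τ, f3 p)
          + ∫ p in (univ : Set Plane) ×ˢ Ioc s τ, f4 p := by
    intro f1 f2 f3 f4 h1 h2 h3 h4
    rw [integral_add' ((h1.add h2).add h3) h4, integral_add' (h1.add h2) h3, integral_add' h1 h2]
  rw [e _ _ _ _ i1 i2 i3 i4]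
  simp only [integral_const_mul]
  rw [← hv.cutoffEnergy_sub b hs hsτ hτ, hv.integral_strip_energyDensity hs hsτ hτ]
  have := hv.integral_bump_scalingDensity_le (hb.trans_le hba) hs hsτ hτ
  rw [errorIntegral]
  linarith

/-- Dominated convergence: the cutoffs are at most `1` and converge pointwise to the indicator of
the closed cone. -/
lemma IsNormalWave.tendsto_cutoffEnergy (hv : IsNormalWave v R) {t : ℝ} (h0 : 0 < t)
    (h1 : t < 1) : Tendsto (fun b => cutoffEnergy v b t) (𝓝[>] 0) (𝓝 (coneEnergy v t)) := by
  refine tendsto_integral_filter_of_dominated_convergence (fun x => energyDensity v (x, t))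
    (Eventually.of_forall fun b => (integrable_slice_mul hv.continuousOn_energyDensity
      hv.vanishes_energyDensity (continuous_cutoff b) h0 h1).aestronglyMeasurable)
    (Eventually.of_forall fun b => Eventually.of_forall fun x => ?_)
    (integrable_slice hv.continuousOn_energyDensity hv.vanishes_energyDensity h0 h1)
    (Eventually.of_forall fun x => (tendsto_cutoff _).mul_const _)
  rw [Real.norm_of_nonneg (mul_nonneg (cutoff_pos _ _).le (energyDensity_nonneg _))]
  exact mul_le_of_le_one_left (energyDensity_nonneg _) (cutoff_le_one _ _)

lemma IsNormalWave.tendsto_errorIntegral (hv : IsNormalWave v R) {s τ : ℝ} (hs : 0 < s)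
    (hτ : τ < 1) : Tendsto (fun b => errorIntegral v b s τ) (𝓝[>] 0) (𝓝 0) := by
  have hi := integrableOn_strip hv.continuousOn_energyDensity hv.vanishes_energyDensity hs hτ
  have h : Tendsto (fun b => errorIntegral v b s τ) (𝓝[>] 0)
      (𝓝 (∫ p in (univ : Set Plane) ×ˢ Ioc s τ, 0 * energyDensity v p)) := by
    refine tendsto_integral_filter_of_dominated_convergence (energyDensity v)
      (Eventually.of_forall fun b => (integrableOn_strip_mul hv.continuousOn_energyDensity
        hv.vanishes_energyDensity (continuous_cutoffError b) hs hτ).aestronglyMeasurable)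
      (Eventually.of_forall fun b => Eventually.of_forall fun x => ?_) hi
      (Eventually.of_forall fun x => (tendsto_cutoffError _).mul_const _)
    rw [Real.norm_of_nonneg (mul_nonneg (cutoffError_nonneg _ _) (energyDensity_nonneg _))]
    exact mul_le_of_le_one_left (energyDensity_nonneg _)
      ((cutoffError_le _ _).trans (by norm_num))
  simpa using h

lemma coneEnergy_nonneg (t : ℝ) : 0 ≤ coneEnergy v t :=
  integral_nonneg fun x => mul_nonneg (by split_ifs <;> norm_num) (energyDensity_nonneg _)

/-- The energy inside the light cone does not decrease. -/
lemma IsNormalWave.coneEnergy_mono (hv : IsNormalWave v R) {s τ : ℝ} (hs : 0 < s)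
    (hsτ : s ≤ τ) (hτ : τ < 1) : coneEnergy v s ≤ coneEnergy v τ := by
  have hl : Tendsto (fun b => cutoffEnergy v b s - 2 / s * errorIntegral v b s τ) (𝓝[>] 0)
      (𝓝 (coneEnergy v s - 2 / s * 0)) :=
    (hv.tendsto_cutoffEnergy hs (hsτ.trans_lt hτ)).sub
      ((hv.tendsto_errorIntegral hs hτ).const_mul _)
  rw [mul_zero, sub_zero] at hl
  refine le_of_tendsto_of_tendsto' hl (hv.tendsto_cutoffEnergy (hs.trans_le hsτ) hτ) fun b => ?_
  have h := hv.cutoffEnergy_sub b hs hsτ hτ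
  have hi1 := (integrableOn_strip_mul hv.continuousOn_energyDensity
        hv.vanishes_energyDensity (continuous_cutoffError b) hs hτ).const_mul (-(2 / s))
  have hi2 := integrableOn_strip_mul hv.continuousOn_scalingDensity hv.vanishes_scalingDensity
    (k := fun q => -2 * cutoffDeriv b q)
    (continuous_const.mul (continuous_cutoffDeriv b)) hs hτ
  have h2 := setIntegral_mono_on hi1 hi2 (measurableSet_strip s τ) fun p hp => by
    have ht : 0 < p.2 := hs.trans hp.2.1
    have hc : 0 ≤ -cutoffDeriv b (coneFn p) := by linarith [cutoffDeriv_nonpos b (coneFn p)]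
    have hD := mul_le_mul_of_nonneg_left (scalingDensity_lower (v := v) ht.le) hc
    have hX : 0 ≤ cutoffError b (coneFn p) * energyDensity v p :=
      mul_nonneg (cutoffError_nonneg _ _) (energyDensity_nonneg _)
    -- The lower bound is on `t D`, so the sign is proved after multiplying by `t`; the factor `2 /
    -- s` suffices since `t ≥ s`.
    have h3 : 0 ≤ p.2 * (-2 * cutoffDeriv b (coneFn p) * scalingDensity v p
        + 2 / s * (cutoffError b (coneFn p) * energyDensity v p)) := by
      have h4 : 1 ≤ p.2 / s := (one_le_div hs).2 hp.2.1.le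
      have h5 : p.2 * (2 / s * (cutoffError b (coneFn p) * energyDensity v p))
          = 2 * (p.2 / s) * (cutoffError b (coneFn p) * energyDensity v p) := by ring
      rw [mul_add, h5]
      have h6 := mul_le_mul_of_nonneg_right h4 hX
      rw [cutoffError] at h6 ⊢
      linarith
    have h7 := nonneg_of_mul_nonneg_right h3 ht
    linarith
  rw [integral_const_mul] at h2
  rw [errorIntegral]
  linarith

end Estimates

/-! ### From the scaling density to the flux through the annulus. -/

section Annulus

variable {u : Plane → ℝ → Target} {R : ℝ}

lemma IsClassical.norm_mul_fluxDensity (hu : IsClassical u) {x : Plane} {t : ℝ}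
    (hp : (x, t) ∈ slab) (hx : x ≠ 0) :
    ‖x‖ * fluxDensity u x t
      = ‖x‖ * energyDensity (fun p : Plane × ℝ => u p.1 p.2) (x, t)
        + ∑ j, x j * momentum (fun p : Plane × ℝ => u p.1 p.2) j (x, t) := by
  have h1 := fun j => hu.dx_eq j hp
  have h2 := hu.dt_eq hp
  simp only at h1 h2
  have hx' : ‖x‖ ≠ 0 := norm_ne_zero_iff.2 hx
  simp only [fluxDensity, gradSq, energyDensity, momentum, h1, h2, Fin.sum_univ_two]
  field_simp

/-- Nonnegativity reduces the limit to an upper bound. -/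
lemma IsClassical.fluxDensity_nonneg (hu : IsClassical u) {x : Plane} {t : ℝ}
    (hp : (x, t) ∈ slab) (hx : x ≠ 0) : 0 ≤ fluxDensity u x t := by
  have h1 := (abs_le.1 (abs_sum_momentum_le (v := fun p : Plane × ℝ => u p.1 p.2) (x, t))).1
  refine nonneg_of_mul_nonneg_right ?_ (norm_pos_iff.2 hx)
  rw [hu.norm_mul_fluxDensity hp hx]
  simp only at h1
  linarith

/-- On an annulus adjacent to the light cone the flux density is controlled by the weighted
scaling density. -/
lemma IsClassical.fluxDensity_le (hu : IsClassical u) {x : Plane} {τ γ b : ℝ}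
    (hp : (x, τ) ∈ slab) (hγ : 0 < γ) (hγ1 : γ < 1) (h1 : γ * τ ≤ ‖x‖) (h2 : ‖x‖ ≤ τ) :
    γ * τ / 2 * fluxDensity u x τ
      ≤ bump (τ ^ 2 * (1 - γ ^ 2)) b (coneFn (x, τ))
          * scalingDensity (fun p : Plane × ℝ => u p.1 p.2) (x, τ) := by
  have hτ : 0 < τ := (mem_slab.1 hp).1
  have hx0 : 0 < ‖x‖ := (mul_pos hγ hτ).trans_le h1
  have hx : x ≠ 0 := norm_pos_iff.1 hx0
  have hf := hu.fluxDensity_nonneg hp hx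
  have hE := energyDensity_nonneg (v := fun p : Plane × ℝ => u p.1 p.2) (x, τ)
  have hD : γ * τ * fluxDensity u x τ
      ≤ scalingDensity (fun p : Plane × ℝ => u p.1 p.2) (x, τ) := by
    refine (mul_le_mul_of_nonneg_right h1 hf).trans ?_
    rw [hu.norm_mul_fluxDensity hp hx, scalingDensity]
    have := mul_le_mul_of_nonneg_right h2 hE
    simp only
    linarith
  have hq : coneFn (x, τ) ≤ 0 := by
    simp only [coneFn]
    nlinarith
  have hq2 : -(τ ^ 2 * (1 - γ ^ 2)) ≤ coneFn (x, τ) := by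
    simp only [coneFn]
    nlinarith [mul_pos hγ hτ]
  have ha : 0 < τ ^ 2 * (1 - γ ^ 2) := mul_pos (by positivity) (by nlinarith)
  -- The inner width is chosen so that `|q|` does not exceed it on the annulus, where the weight is
  -- then at least `1 / (1 + 1)`.
  have hb : 1 / 2 ≤ bump (τ ^ 2 * (1 - γ ^ 2)) b (coneFn (x, τ)) := by
    rw [bump_of_nonpos _ _ hq, bump_self, one_div]
    refine inv_anti₀ (by positivity) ?_
    have h3 : (coneFn (x, τ) / (τ ^ 2 * (1 - γ ^ 2))) ^ 2 ≤ 1 := by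
      rw [div_pow, div_le_one (by positivity)]
      nlinarith
    linarith
  have hD0 : 0 ≤ γ * τ * fluxDensity u x τ := by positivity
  calc γ * τ / 2 * fluxDensity u x τ = 1 / 2 * (γ * τ * fluxDensity u x τ) := by ring
    _ ≤ _ := mul_le_mul hb hD hD0 (by linarith)

/-- `D` can be negative only outside the cone, where the weight has width `b`; the loss of order `b`
lets the annulus integral be extended to the whole plane. -/
lemma bump_mul_scalingDensity_lower {v : Plane × ℝ → Target} {a b : ℝ} {p : Plane × ℝ}
    (hb : 0 < b) (hp : 0 < p.2) :
    0 ≤ bump a b (coneFn p) * scalingDensity v p + b / (2 * p.2) * energyDensity v p := by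
  have hD := mul_le_mul_of_nonneg_left (scalingDensity_lower (v := v) hp.le)
    (bump_pos a b (coneFn p)).le
  have hE := energyDensity_nonneg (v := v) p
  have hq : bump a b (coneFn p) * max (coneFn p) 0 ≤ b / 2 := by
    rcases le_total (coneFn p) 0 with h | h
    · rw [max_eq_right h, mul_zero]
      positivity
    · rw [max_eq_left h, bump_of_nonneg a b h, cutoff_eq_bump_self b h, mul_comm]
      exact mul_bump_self_le hb
  refine nonneg_of_mul_nonneg_right ?_ hp
  have h1 : p.2 * (b / (2 * p.2) * energyDensity v p) = b / 2 * energyDensity v p := by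
    field_simp
  rw [mul_add, h1]
  have := mul_le_mul_of_nonneg_right hq hE
  linarith

/-- The flux integral over the annulus `γτ ≤ |x| < τ` at time `τ`. -/
def annulusFlux (u : Plane → ℝ → Target) (τ γ : ℝ) : ℝ :=
  ∫ x in Metric.ball (0 : Plane) τ \ Metric.ball (0 : Plane) (γ * τ), fluxDensity u x τ

lemma IsClassical.annulusFlux_nonneg (hu : IsClassical u) {τ γ : ℝ} (h0 : 0 < τ) (h1 : τ < 1)
    (hγ : 0 < γ) : 0 ≤ annulusFlux u τ γ := by
  refine setIntegral_nonneg (measurableSet_ball.diff measurableSet_ball) fun x hx => ?_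
  refine hu.fluxDensity_nonneg (mem_slab.2 ⟨h0, h1⟩) fun h => ?_
  refine hx.2 ?_
  simpa [h] using mul_pos hγ h0

lemma IsClassical.annulusFlux_le (hu : IsClassical u)
    (hv : IsNormalWave (fun p : Plane × ℝ => u p.1 p.2) R) {τ γ b : ℝ} (hτ : 0 < τ)
    (hτ1 : τ < 1) (hγ : 0 < γ) (hγ1 : γ < 1) (hb : 0 < b) :
    γ * τ / 2 * annulusFlux u τ γ
      ≤ (∫ x, bump (τ ^ 2 * (1 - γ ^ 2)) b (coneFn (x, τ))
          * scalingDensity (fun p : Plane × ℝ => u p.1 p.2) (x, τ))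
        + b / (2 * τ) * totalEnergy (fun p : Plane × ℝ => u p.1 p.2) := by
  have i1 := integrable_slice_mul hv.continuousOn_scalingDensity hv.vanishes_scalingDensity
    (continuous_bump (τ ^ 2 * (1 - γ ^ 2)) b) hτ hτ1
  have i2 := (integrable_slice hv.continuousOn_energyDensity hv.vanishes_energyDensity
    hτ hτ1).const_mul (b / (2 * τ))
  have hm : MeasurableSet (Metric.ball (0 : Plane) τ \ Metric.ball (0 : Plane) (γ * τ)) :=
    measurableSet_ball.diff measurableSet_ball
  have hs : ∀ x : Plane, (x, τ) ∈ slab := fun x => mem_slab.2 ⟨hτ, hτ1⟩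
  rw [← hv.integral_energyDensity hτ hτ1, ← integral_const_mul, ← integral_add i1 i2,
    annulusFlux, ← integral_const_mul, ← integral_indicator hm]
  refine integral_mono_of_nonneg (Eventually.of_forall fun x => ?_) (i1.add i2)
    (Eventually.of_forall fun x => ?_)
  · refine indicator_nonneg (fun x hx => mul_nonneg (by positivity)
      (hu.fluxDensity_nonneg (hs x) fun h => hx.2 ?_)) x
    simpa [h] using mul_pos hγ hτ
  · have hE := energyDensity_nonneg (v := fun p : Plane × ℝ => u p.1 p.2) (x, τ)
    by_cases hx : x ∈ Metric.ball (0 : Plane) τ \ Metric.ball (0 : Plane) (γ * τ)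
    · rw [indicator_of_mem hx]
      have h1 : ‖x‖ < τ := by simpa using hx.1
      have h2 : γ * τ ≤ ‖x‖ := by simpa using hx.2
      have h3 := hu.fluxDensity_le (b := b) (hs x) hγ hγ1 h2 h1.le
      have h4 : 0 ≤ b / (2 * τ) * energyDensity (fun p : Plane × ℝ => u p.1 p.2) (x, τ) := by
        positivity
      simp only
      linarith
    · rw [indicator_of_notMem hx]
      exact bump_mul_scalingDensity_lower hb hτ

/-- The estimate for the flux through the annulus, with the time scale `ε τ`. -/
lemma IsClassical.annulusFlux_bound (hu : IsClassical u)
    (hv : IsNormalWave (fun p : Plane × ℝ => u p.1 p.2) R) {τ γ ε : ℝ} (hτ : 0 < τ)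
    (hτ1 : τ < 1) (hγ : 0 < γ) (hγ1 : γ < 1) (hε : 0 < ε) (hε1 : ε ≤ 1 / 2) :
    γ / 2 * annulusFlux u τ γ
      ≤ (1 - γ ^ 2) * (Real.pi / (2 * ε) + 2) * totalEnergy (fun p : Plane × ℝ => u p.1 p.2)
        + 2 * (coneEnergy (fun p : Plane × ℝ => u p.1 p.2) τ
          - coneEnergy (fun p : Plane × ℝ => u p.1 p.2) ((1 - ε) * τ))
        + 2 * ε * totalEnergy (fun p : Plane × ℝ => u p.1 p.2) := by
  set v : Plane × ℝ → Target := fun p => u p.1 p.2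
  set a := τ ^ 2 * (1 - γ ^ 2) with ha_def
  set s := (1 - ε) * τ with hs_def
  have hγ2 : 0 < 1 - γ ^ 2 := by nlinarith
  have ha : 0 < a := mul_pos (by positivity) hγ2
  have hs : 0 < s := mul_pos (by linarith) hτ
  have hsτ : s ≤ τ := by nlinarith
  have hτs : τ ≤ 2 * s := by nlinarith
  have hT : τ - s = ε * τ := by rw [hs_def]; ring
  have hE0 : 0 ≤ totalEnergy v := totalEnergy_nonneg
  have hlim : Tendsto (fun b => a / 2 * Real.pi * totalEnergy v
        + 2 * τ * (τ - s) * (cutoffEnergy v b τ - cutoffEnergy v b s)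
        + (a / s + 2 * (τ - s)) * ((τ - s) * totalEnergy v)
        + 10 * (τ - s) * errorIntegral v b s τ + (τ - s) * (b / (2 * τ) * totalEnergy v)) (𝓝[>] 0)
      (𝓝 (a / 2 * Real.pi * totalEnergy v
        + 2 * τ * (τ - s) * (coneEnergy v τ - coneEnergy v s)
        + (a / s + 2 * (τ - s)) * ((τ - s) * totalEnergy v)
        + 10 * (τ - s) * 0 + (τ - s) * (0 / (2 * τ) * totalEnergy v))) := by
    have hid : Tendsto (fun b : ℝ => b) (𝓝[>] 0) (𝓝 0) := tendsto_nhdsWithin_of_tendsto_nhds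
      tendsto_id
    exact ((((((hv.tendsto_cutoffEnergy hτ hτ1).sub (hv.tendsto_cutoffEnergy hs
      (hsτ.trans_lt hτ1))).const_mul _).const_add _).add_const _).add
      ((hv.tendsto_errorIntegral hs hτ1).const_mul _)).add
      (((hid.div_const _).mul_const _).const_mul _)
  have hle := ge_of_tendsto (b := (τ - s) * (γ * τ / 2 * annulusFlux u τ γ)) hlim <| by
    filter_upwards [Ioc_mem_nhdsGT ha] with b hb
    have h1 := hv.bump_scalingDensity_le hb.1 hb.2 hs hsτ hτs hτ1
    have h2 := mul_le_mul_of_nonneg_left (hu.annulusFlux_le hv hτ hτ1 hγ hγ1 hb.1)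
      (sub_nonneg.2 hsτ)
    rw [mul_add] at h2
    linarith
  -- Uses `s ≥ τ / 2`, that is `ε ≤ 1 / 2`.
  have has : a / s ≤ 2 * (1 - γ ^ 2) * τ := by
    rw [div_le_iff₀ hs, ha_def]
    nlinarith [mul_pos hγ2 hτ]
  have hpos : 0 < ε * τ ^ 2 := by positivity
  -- The common factor `ε τ²` is `τ - s = ε τ` times the `τ` from comparing the flux density with
  -- `D`.
  refine le_of_mul_le_mul_left ?_ hpos
  rw [hT] at hle
  have h3 : (a / s) * (ε * τ * totalEnergy v)
      ≤ 2 * (1 - γ ^ 2) * τ * (ε * τ * totalEnergy v) :=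
    mul_le_mul_of_nonneg_right has (by positivity)
  have h4 : ε * τ ^ 2 * ((1 - γ ^ 2) * (Real.pi / (2 * ε) + 2) * totalEnergy v)
      = a / 2 * Real.pi * totalEnergy v + 2 * (1 - γ ^ 2) * τ * (ε * τ * totalEnergy v) := by
    rw [ha_def]
    field_simp
  rw [mul_add, mul_add, h4]
  rw [zero_div] at hle
  linarith

/-- A monotone function bounded below has a limit at the left endpoint. This replaces any regularity
at `t = 0`. -/
lemma IsNormalWave.exists_tendsto_coneEnergy {v : Plane × ℝ → Target} (hv : IsNormalWave v R) :
    ∃ L, Tendsto (coneEnergy v) (𝓝[>] 0) (𝓝 L) := by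
  refine ⟨_, MonotoneOn.tendsto_nhdsWithin_Ioo_right (x := (0 : ℝ)) (y := 1)
    (nonempty_Ioo.2 one_pos) (fun s hs τ hτ h => hv.coneEnergy_mono hs.1 h hτ.2) ⟨0, ?_⟩⟩
  rintro _ ⟨t, _, rfl⟩
  exact coneEnergy_nonneg t

theorem IsClassical.tendsto_annulusFlux (hu : IsClassical u) {τ γ : ℕ → ℝ}
    (hτ : Tendsto τ atTop (𝓝[>] 0)) (hγ : Tendsto γ atTop (𝓝[<] 1)) :
    Tendsto (fun n => annulusFlux u (τ n) (γ n)) atTop (𝓝 0) := by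
  obtain ⟨R, hv⟩ := hu.exists_isNormalWave
  set v : Plane × ℝ → Target := fun p => u p.1 p.2
  obtain ⟨L, hL⟩ := hv.exists_tendsto_coneEnergy
  have hE0 : 0 ≤ totalEnergy v := totalEnergy_nonneg
  have hγ' : Tendsto γ atTop (𝓝 1) := tendsto_nhds_of_tendsto_nhdsWithin hγ
  have hτI : ∀ᶠ n in atTop, τ n ∈ Ioo (0 : ℝ) 1 := hτ.eventually (Ioo_mem_nhdsGT one_pos)
  have hγI : ∀ᶠ n in atTop, γ n ∈ Ioo (1 / 2 : ℝ) 1 :=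
    hγ.eventually (Ioo_mem_nhdsLT (by norm_num))
  refine tendsto_order.2 ⟨fun l hl => ?_, fun δ hδ => ?_⟩
  · filter_upwards [hτI, hγI] with n h1 h2
    exact hl.trans_le (hu.annulusFlux_nonneg h1.1 h1.2 (by linarith [h2.1]))
  -- The target `δ / 4` matches the factor `γ / 2 ≥ 1 / 4` in front of the flux once `γ > 1 / 2`.
  obtain ⟨ε, hε, hε1, hεE⟩ : ∃ ε : ℝ, 0 < ε ∧ ε ≤ 1 / 2 ∧ 2 * ε * totalEnergy v < δ / 4 := by
    refine ⟨min (1 / 2) (δ / (16 * (totalEnergy v + 1))), lt_min (by norm_num) (by positivity),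
      min_le_left _ _, ?_⟩
    have h1 := min_le_right (1 / 2) (δ / (16 * (totalEnergy v + 1)))
    rw [le_div_iff₀ (by positivity)] at h1
    have h2 : 0 < min (1 / 2) (δ / (16 * (totalEnergy v + 1))) :=
      lt_min (by norm_num) (by positivity)
    linarith
  have hτε : Tendsto (fun n => (1 - ε) * τ n) atTop (𝓝[>] 0) := by
    refine tendsto_nhdsWithin_iff.2 ⟨?_, ?_⟩
    · simpa using (tendsto_nhds_of_tendsto_nhdsWithin hτ).const_mul (1 - ε)
    · filter_upwards [hτI] with n hn
      exact mul_pos (by linarith) hn.1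
  -- For fixed `ε` the first term vanishes as `γ → 1`, and both cone energies tend to the same `L`.
  have hlim : Tendsto (fun n => (1 - γ n ^ 2) * (Real.pi / (2 * ε) + 2) * totalEnergy v
      + 2 * (coneEnergy v (τ n) - coneEnergy v ((1 - ε) * τ n)) + 2 * ε * totalEnergy v) atTop
      (𝓝 ((1 - 1 ^ 2) * (Real.pi / (2 * ε) + 2) * totalEnergy v + 2 * (L - L)
        + 2 * ε * totalEnergy v)) :=
    (((((hγ'.pow 2).const_sub 1).mul_const _).mul_const _).add
      (((hL.comp hτ).sub (hL.comp hτε)).const_mul 2)).add_const _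
  rw [one_pow, sub_self, sub_self, zero_mul, zero_mul, mul_zero, zero_add, zero_add] at hlim
  have hlt := hlim.eventually (gt_mem_nhds hεE)
  filter_upwards [hτI, hγI, hlt] with n h1 h2 h3
  have h4 := hu.annulusFlux_bound hv h1.1 h1.2 (by linarith [h2.1]) h2.2 hε hε1
  have h5 := hu.annulusFlux_nonneg h1.1 h1.2 (by linarith [h2.1] : 0 < γ n)
  have h6 := mul_le_mul_of_nonneg_right h2.1.le h5
  linarith

end Annulus

end WaveMap

end

theorem mainTheorem7
    (u : EuclideanSpace ℝ (Fin 2) → ℝ → EuclideanSpace ℝ (Fin 3))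
    (hu : WaveMap.IsClassical u)
    (τ γ : ℕ → ℝ)
    (hτ : Filter.Tendsto τ Filter.atTop (nhdsWithin 0 (Set.Ioi 0)))
    (hγ : Filter.Tendsto γ Filter.atTop (nhdsWithin 1 (Set.Iio 1))) :
    Filter.Tendsto
      (fun n => ∫ x in Metric.ball (0 : EuclideanSpace ℝ (Fin 2)) (τ n) \
          Metric.ball (0 : EuclideanSpace ℝ (Fin 2)) (γ n * τ n),
        WaveMap.fluxDensity u x (τ n))
      Filter.atTop (nhds 0) := by
  exact hu.tendsto_annulusFlux hτ hγ
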